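/- Let $n\ge 2$, let $S^{n-1}$ be the unit sphere of $\mathbb{R}^n$ and $d\xi$ its spherical Lebesgue measure. Let $\mathcal{C}$ be the set of functions $G:S^{n-1}\times(0,\infty)\to\mathbb{R}$ such that $G$ and $G_t=\partial G/\partial t$ (derivative in the second variable) are continuous on $S^{n-1}\times(0,\infty)$, and let $\mathcal{C}_I$ (resp. $\mathcal{C}_d$) be the set of $G\in\mathcal{C}$ with $G_t>0$ (resp. $G_t<0$) everywhere. For a convex body $K\subset\mathbb{R}^n$ containing the origin in its interior put $h_K(x)=\max_{y\in K}x\cdot y$, $\rho_K(x)=\max\{r\ge 0: rx\in K\}$ and $K^*=\{x: x\cdot y\le 1\ \forall y\in K\}$. For $\omega\subseteq S^{n-1}$ let $\boldsymbol{\alpha}^*_K(\omega)$ be the set of $\xi\in S^{n-1}$ such that $K$ has an outer unit normal in $\omega$ at the boundary point $\rho_K(\xi)\xi$, and for almost all $\xi\in S^{n-1}$ let $\alpha_K(\xi)$ be the unique outer unit normal of $K$ at $\rho_K(\xi)\xi$. For $\Theta=(G,\Psi,\lambda)$ with $G\in\mathcal{C}$, $\Psi\in\mathcal{C}_I\cup\mathcal{C}_d$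 and $\lambda$ a nonzero finite Borel measure on $S^{n-1}$ that is absolutely continuous with respect to $d\xi$, define $$\widetilde V_{G,\lambda}(K)=\int_{S^{n-1}}G(\xi,\rho_K(\xi))\,d\lambda(\xi)$$ and, for Borel sets $\omega\subseteq S^{n-1}$, $$\widetilde C_\Theta(K,\omega)=\int_{\boldsymbol{\alpha}^*_K(\omega)}\frac{\rho_K(\xi)\,G_t(\xi,\rho_K(\xi))}{h_K(\alpha_K(\xi))\,\Psi_t(\alpha_K(\xi),h_K(\alpha_K(\xi)))}\,d\lambda(\xi),$$ $$C_\Theta(K,\omega)=\int_{\boldsymbol{\alpha}^*_K(\omega)}\frac{\rho_K(\xi)\,G_t(\xi,\rho_K(\xi))}{\rho_{K^*}(\alpha_K(\xi))\,\Psi_t(\alpha_K(\xi),\rho_{K^*}(\alpha_K(\xi)))}\,d\lambda(\xi).$$ **Theorem.** Let $\Omega\subseteq S^{n-1}$ be a closed set that is not contained in any closed hemisphere, let $\Theta=(G,\Psi,\lambda)$ be as above, let $f:\Omega\to(0,\infty)$ and $g:\Omega\to\mathbb{R}$ be continuous, and let $f_\varepsilon$ be the Musielak-Orlicz perturbation of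 $f$, determined by $f_\varepsilon>0$ and $$\Psi(\xi,f_\varepsilon(\xi))=\Psi(\xi,f(\xi))+\varepsilon g(\xi),\qquad \xi\in\Omega.$$ For a positive continuous function $k$ on $\Omega$ let $[k]=\bigcap_{\xi\in\Omega}\{x\in\mathbb{R}^n: x\cdot\xi\le k(\xi)\}$ be its Wulff shape and let $\langle k\rangle$ be the smallest closed convex set containing $\{k(\xi)\xi:\xi\in\Omega\}$. Then $f_\varepsilon$ is well defined, positive and continuous on $\Omega$ for all $\varepsilon\in\mathbb{R}$ with $|\varepsilon|$ small enough; $C_\Theta(\langle f\rangle^*,\cdot)$ and $\widetilde C_\Theta([f],\cdot)$ are well-defined finite signed Borel measures on $S^{n-1}$; and $$\lim_{\varepsilon\to0}\frac{\widetilde V_{G,\lambda}(\langle f_\varepsilon\rangle^*)-\widetilde V_{G,\lambda}(\langle f\rangle^*)}{\varepsilon}=-\int_\Omega g(u)\,dC_\Theta(\langle f\rangle^*,u),$$ $$\lim_{\varepsilon\to0}\frac{\widetilde V_{G,\lambda}([f_\varepsilon])-\widetilde V_{G,\lambda}([f])}{\varepsilon}=\int_\Omega g(u)\,d\widetilde C_\Theta([f],u).$$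 -/

import Mathlib

open MeasureTheory Set Filter Topology

noncomputable section

namespace MusielakOrlicz

/-- Euclidean space `ℝⁿ`. -/
abbrev Rn (n : ℕ) : Type := EuclideanSpace ℝ (Fin n)

/-- The unit sphere `S^{n-1}` of `ℝⁿ`, with its Borel σ-algebra. -/
abbrev Sph (n : ℕ) : Type := Metric.sphere (0 : Rn n) 1

/-- The canonical spherical Lebesgue measure `dξ` on `S^{n-1}`. -/
abbrev sphMeasure (n : ℕ) : Measure (Sph n) := (volume : Measure (Rn n)).toSphere

/-! ### Function and measure classes -/

/-- The partial derivative `G_t(ξ, t)` in the second variable. Functions on `S^{n-1} × (0, ∞)` are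
represented by functions on `S^{n-1} × ℝ` of which only the values at `t > 0` matter. -/
def partialT {n : ℕ} (G : Sph n → ℝ → ℝ) (ξ : Sph n) (t : ℝ) : ℝ := deriv (G ξ) t

/-- The class `𝒞`: `G` and `G_t` exist and are continuous on `S^{n-1} × (0, ∞)`. -/
structure ClassC {n : ℕ} (G : Sph n → ℝ → ℝ) : Prop where
  continuousOn : ContinuousOn (fun p : Sph n × ℝ => G p.1 p.2) (univ ×ˢ Ioi (0 : ℝ))
  differentiableAt : ∀ ξ : Sph n, ∀ t : ℝ, 0 < t → DifferentiableAt ℝ (G ξ) t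
  continuousOn_partialT :
    ContinuousOn (fun p : Sph n × ℝ => partialT G p.1 p.2) (univ ×ˢ Ioi (0 : ℝ))

/-- The class `𝒞_I`: members of `𝒞` with `G_t > 0` on `S^{n-1} × (0, ∞)`. -/
def ClassCI {n : ℕ} (G : Sph n → ℝ → ℝ) : Prop :=
  ClassC G ∧ ∀ ξ : Sph n, ∀ t : ℝ, 0 < t → 0 < partialT G ξ t

/-- The class `𝒞_d`: members of `𝒞` with `G_t < 0` on `S^{n-1} × (0, ∞)`. -/
def ClassCd {n : ℕ} (G : Sph n → ℝ → ℝ) : Prop :=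
  ClassC G ∧ ∀ ξ : Sph n, ∀ t : ℝ, 0 < t → partialT G ξ t < 0

/-- The class `ℳ`: nonzero finite Borel measures on `S^{n-1}` that are absolutely continuous with
respect to `dξ`. -/
structure ClassM {n : ℕ} (lam : Measure (Sph n)) : Prop where
  finite : IsFiniteMeasure lam
  ne_zero : lam ≠ 0
  absolutelyContinuous : lam ≪ sphMeasure n

/-- `Ω ⊆ S^{n-1}` is contained in some closed hemisphere. -/
def InClosedHemisphere {n : ℕ} (Ω : Set (Sph n)) : Prop :=
  ∃ u : Sph n, ∀ ξ ∈ Ω, 0 ≤ inner ℝ (u : Rn n) (ξ : Rn n)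

/-! ### Convex bodies -/

/-- Support function `h_K(x) = max {x · y : y ∈ K}`. -/
def supportFn {n : ℕ} (K : Set (Rn n)) (x : Rn n) : ℝ := sSup ((fun y => inner ℝ x y) '' K)

/-- Radial function `ρ_K(x) = max {r ≥ 0 : r x ∈ K}`. -/
def radialFn {n : ℕ} (K : Set (Rn n)) (x : Rn n) : ℝ := sSup {r : ℝ | 0 ≤ r ∧ r • x ∈ K}

/-- Polar body `K^* = {x : x · y ≤ 1 for all y ∈ K}`. -/
def polarBody {n : ℕ} (K : Set (Rn n)) : Set (Rn n) := {x | ∀ y ∈ K, inner ℝ x y ≤ 1}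

/-- Wulff shape `[f]` generated by `f` on `Ω`. -/
def wulff {n : ℕ} (Ω : Set (Sph n)) (f : Sph n → ℝ) : Set (Rn n) :=
  ⋂ ξ ∈ Ω, {x : Rn n | inner ℝ x (ξ : Rn n) ≤ f ξ}

/-- Convex hull `⟨f⟩` generated by `f` on `Ω`: the smallest closed convex set containing all
`f(ξ) ξ`, `ξ ∈ Ω`. -/
def hull {n : ℕ} (Ω : Set (Sph n)) (f : Sph n → ℝ) : Set (Rn n) :=
  closedConvexHull ℝ ((fun ξ : Sph n => f ξ • (ξ : Rn n)) '' Ω)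

/-- Radial Gauss image of a point: the set of all outer unit normals of `K` at the boundary point
`ρ_K(ξ) ξ`. -/
def radialGaussImage {n : ℕ} (K : Set (Rn n)) (ξ : Sph n) : Set (Sph n) :=
  {u | inner ℝ (radialFn K ξ • (ξ : Rn n)) (u : Rn n) = supportFn K u}

/-- Reverse radial Gauss image of a set `ω`: the directions of all boundary points of `K` that have
an outer unit normal in `ω`. -/
def revRadialGaussImage {n : ℕ} (K : Set (Rn n)) (ω : Set (Sph n)) : Set (Sph n) :=
  {ξ | ∃ u ∈ ω, inner ℝ (radialFn K ξ • (ξ : Rn n)) (u : Rn n) = supportFn K u}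

open Classical in
/-- The radial Gauss map `α_K`: the unique element of the radial Gauss image of `ξ` where the latter
is a singleton, that is, outside a null set; on that null set an arbitrary outer normal. -/
def radialGaussMap {n : ℕ} (K : Set (Rn n)) (ξ : Sph n) : Sph n :=
  if h : (radialGaussImage K ξ).Nonempty then h.some else ξ

/-! ### Dual volume, Musielak-Orlicz addition and Gauss image measures -/

/-- General dual volume `∫ G(ξ, ρ_K(ξ)) dλ(ξ)` of `K` with respect to `λ`. -/
def dualVolume {n : ℕ} (G : Sph n → ℝ → ℝ) (lam : Measure (Sph n)) (K : Set (Rn n)) : ℝ :=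
  ∫ ξ, G ξ (radialFn K ξ) ∂lam

/-- Musielak-Orlicz addition `f_ε(ξ) = ψ_ξ⁻¹(ψ_ξ(f(ξ)) + ε g(ξ))`, where `ψ_ξ = Ψ(ξ, ·)` is inverted
on `(0, ∞)`. -/
def moAdd {n : ℕ} (Ψ : Sph n → ℝ → ℝ) (f g : Sph n → ℝ) (ε : ℝ) (ξ : Sph n) : ℝ :=
  Function.invFunOn (Ψ ξ) (Ioi (0 : ℝ)) (Ψ ξ (f ξ) + ε * g ξ)

/-- The integrand of the Musielak-Orlicz-Gauss image measure:
`ρ_K(ξ) G_t(ξ, ρ_K(ξ)) / (h_K(α_K(ξ)) Ψ_t(α_K(ξ), h_K(α_K(ξ))))`. -/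
def moDensity {n : ℕ} (G Ψ : Sph n → ℝ → ℝ) (K : Set (Rn n)) (ξ : Sph n) : ℝ :=
  (radialFn K ξ * partialT G ξ (radialFn K ξ)) /
    (supportFn K (radialGaussMap K ξ) *
      partialT Ψ (radialGaussMap K ξ) (supportFn K (radialGaussMap K ξ)))

/-- The integrand of the polar Musielak-Orlicz-Gauss image measure:
`ρ_K(ξ) G_t(ξ, ρ_K(ξ)) / (ρ_{K^*}(α_K(ξ)) Ψ_t(α_K(ξ), ρ_{K^*}(α_K(ξ))))`. -/
def polarMODensity {n : ℕ} (G Ψ : Sph n → ℝ → ℝ) (K : Set (Rn n)) (ξ : Sph n) : ℝ :=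
  (radialFn K ξ * partialT G ξ (radialFn K ξ)) /
    (radialFn (polarBody K) (radialGaussMap K ξ) *
      partialT Ψ (radialGaussMap K ξ) (radialFn (polarBody K) (radialGaussMap K ξ)))

/-- `μ` is the Musielak-Orlicz-Gauss image measure of `K` for `Θ = (G, Ψ, λ)`: its value on every
Borel set `ω` is the (well-defined) integral of `moDensity` over the reverse radial Gauss image of
`ω`. These values determine the signed measure `μ`. -/
def IsMOGaussImageMeasure {n : ℕ} (G Ψ : Sph n → ℝ → ℝ) (lam : Measure (Sph n))
    (K : Set (Rn n)) (μ : SignedMeasure (Sph n)) : Prop :=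
  ∀ ω : Set (Sph n), MeasurableSet ω →
    NullMeasurableSet (revRadialGaussImage K ω) lam ∧
    IntegrableOn (moDensity G Ψ K) (revRadialGaussImage K ω) lam ∧
    μ ω = ∫ ξ in revRadialGaussImage K ω, moDensity G Ψ K ξ ∂lam

/-- `μ` is the polar Musielak-Orlicz-Gauss image measure of `K` for `Θ = (G, Ψ, λ)`. -/
def IsPolarMOGaussImageMeasure {n : ℕ} (G Ψ : Sph n → ℝ → ℝ) (lam : Measure (Sph n))
    (K : Set (Rn n)) (μ : SignedMeasure (Sph n)) : Prop :=
  ∀ ω : Set (Sph n), MeasurableSet ω →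
    NullMeasurableSet (revRadialGaussImage K ω) lam ∧
    IntegrableOn (polarMODensity G Ψ K) (revRadialGaussImage K ω) lam ∧
    μ ω = ∫ ξ in revRadialGaussImage K ω, polarMODensity G Ψ K ξ ∂lam

end MusielakOrlicz

end

open MeasureTheory Set Filter Topology

noncomputable section

namespace MusielakOrlicz

/-! ### Signed measures with a density, pushed forward -/

theorem lsmul_flip_real :
    (ContinuousLinearMap.lsmul ℝ ℝ : ℝ →L[ℝ] ℝ →L[ℝ] ℝ).flip = ContinuousLinearMap.lsmul ℝ ℝ := by
  ext
  simp

theorem setIntegral_map_withDensity_ofReal {X Y : Type*} [MeasurableSpace X] [MeasurableSpace Y]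
    {m : Measure X} {A : X → Y} (hA : Measurable A) {D : X → ℝ} (hD : Integrable D m)
    {s : Set Y} (hs : MeasurableSet s) {φ : Y → ℝ} (hφ : Measurable φ) :
    ∫ y in s, φ y ∂((m.withDensity fun x => ENNReal.ofReal (D x)).map A) =
      ∫ x in A ⁻¹' s, max (D x) 0 * φ (A x) ∂m := by
  rw [setIntegral_map hs hφ.aestronglyMeasurable hA.aemeasurable,
    setIntegral_withDensity_eq_setIntegral_toReal_smul₀
      hD.aestronglyMeasurable.aemeasurable.ennreal_ofReal.restrict
      (Eventually.of_forall fun _ => ENNReal.ofReal_lt_top) _ (hA hs)]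
  simp [ENNReal.toReal_ofReal']

/-- The image under `A` of the signed measure with density `D` with respect to `m`. -/
theorem exists_signedMeasure_map_density {X Y : Type*} [MeasurableSpace X] [MeasurableSpace Y]
    {m : Measure X} {A : X → Y} (hA : Measurable A) {D : X → ℝ} (hD : Integrable D m) :
    ∃ C : SignedMeasure Y,
      (∀ ω, MeasurableSet ω → C ω = ∫ x in A ⁻¹' ω, D x ∂m) ∧
      ∀ s, MeasurableSet s → ∀ φ : Y → ℝ, Measurable φ → (∃ M, ∀ y, |φ y| ≤ M) →
        ∫ᵛ y in s, φ y ∂•C = ∫ x in A ⁻¹' s, D x * φ (A x) ∂m := by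
  have : IsFiniteMeasure (m.withDensity fun x => ENNReal.ofReal (D x)) :=
    isFiniteMeasure_withDensity_ofReal hD.2
  have : IsFiniteMeasure (m.withDensity fun x => ENNReal.ofReal ((-D) x)) :=
    isFiniteMeasure_withDensity_ofReal hD.neg.2
  set P := (m.withDensity fun x => ENNReal.ofReal (D x)).map A with hP
  set N := (m.withDensity fun x => ENNReal.ofReal ((-D) x)).map A with hN
  have key : ∀ s, MeasurableSet s → ∀ φ : Y → ℝ, Measurable φ → (∃ M, ∀ y, |φ y| ≤ M) →
      ∫ y in s, φ y ∂P - ∫ y in s, φ y ∂N = ∫ x in A ⁻¹' s, D x * φ (A x) ∂m := by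
    rintro s hs φ hφ ⟨M, hM⟩
    have hb : ∀ {E : X → ℝ}, Integrable E m →
        IntegrableOn (fun x => max (E x) 0 * φ (A x)) (A ⁻¹' s) m := fun hE =>
      (hE.pos_part.mul_bdd (c := M) (hφ.comp hA).aestronglyMeasurable
        (Eventually.of_forall fun x => hM (A x))).integrableOn
    rw [setIntegral_map_withDensity_ofReal hA hD hs hφ,
      setIntegral_map_withDensity_ofReal hA hD.neg hs hφ, ← integral_sub (hb hD) (hb hD.neg)]
    congr with x
    rw [← sub_mul, Pi.neg_apply, max_zero_sub_max_neg_zero_eq_self]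
  refine ⟨P.toSignedMeasure - N.toSignedMeasure, fun ω hω => ?_, fun s hs φ hφ hM => ?_⟩
  · have := key ω hω (fun _ => 1) measurable_const ⟨1, by simp⟩
    simp only [integral_const, smul_eq_mul, mul_one, measureReal_restrict_apply_univ] at this
    simp [Measure.toSignedMeasure_apply_measurable hω, this]
  · rw [← key s hs φ hφ hM, VectorMeasure.restrict_sub,
      VectorMeasure.integral_sub_vectorMeasure, ← VectorMeasure.setIntegral_toSignedMeasure hs,
      ← VectorMeasure.setIntegral_toSignedMeasure hs, lsmul_flip_real]
    all_goals
      obtain ⟨M, hM⟩ := hM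
      refine VectorMeasure.Integrable.restrict ?_
      rw [VectorMeasure.Integrable, Measure.variation_toSignedMeasure]
      exact Integrable.of_bound hφ.aestronglyMeasurable M (Eventually.of_forall hM)

/-! ### Almost everywhere differentiability on the sphere -/

/-- A positively homogeneous Lipschitz function is differentiable at almost every point of the
unit sphere. -/
theorem ae_sphMeasure_differentiableAt {n : ℕ} {N : Rn n → ℝ} {C : NNReal}
    (hN : LipschitzWith C N) (hhom : ∀ t : ℝ, 0 ≤ t → ∀ x, N (t • x) = t * N x) :
    ∀ᵐ ξ : Sph n ∂sphMeasure n, DifferentiableAt ℝ N ξ := by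
  have hmeas : MeasurableSet {ξ : Sph n | ¬ DifferentiableAt ℝ N ξ} :=
    ((measurableSet_of_differentiableAt ℝ N).preimage measurable_subtype_coe).compl
  rw [ae_iff, sphMeasure, Measure.toSphere_apply' _ hmeas]
  have hnull : volume {x : Rn n | ¬ DifferentiableAt ℝ N x} = 0 :=
    ae_iff.1 hN.ae_differentiableAt
  refine mul_eq_zero_of_right _ (measure_mono_null ?_ hnull)
  rintro _ ⟨t, ht, _, ⟨ξ, hξ, rfl⟩, rfl⟩ hd
  apply hξ
  have h1 : DifferentiableAt ℝ (fun x : Rn n => t⁻¹ * N (t • x)) ξ := by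
    refine DifferentiableAt.const_mul ?_ _
    exact DifferentiableAt.comp (g := N) (ξ : Rn n) hd (by fun_prop)
  refine h1.congr_of_eventuallyEq (Eventually.of_forall fun x => ?_)
  simp only
  rw [hhom t ht.1.le, inv_mul_cancel_left₀ ht.1.ne']

/-! ### Compactness bounds -/

theorem exists_pos_le_of_isCompact {X : Type*} [TopologicalSpace X] {s : Set X} (hs : IsCompact s)
    {f : X → ℝ} (hf : ContinuousOn f s) (hpos : ∀ x ∈ s, 0 < f x) : ∃ c, 0 < c ∧ ∀ x ∈ s, c ≤ f x := by
  rcases s.eq_empty_or_nonempty with rfl | hne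
  · exact ⟨1, one_pos, by simp⟩
  · obtain ⟨x, hx, h⟩ := hs.exists_isMinOn hne hf
    exact ⟨f x, hpos x hx, fun y hy => h hy⟩

theorem exists_abs_le_of_isCompact {X : Type*} [TopologicalSpace X] {s : Set X} (hs : IsCompact s)
    {f : X → ℝ} (hf : ContinuousOn f s) : ∃ M, 0 ≤ M ∧ ∀ x ∈ s, |f x| ≤ M := by
  obtain ⟨M, hM⟩ := hs.exists_bound_of_continuousOn hf
  exact ⟨max M 0, le_max_right _ _, fun x hx => (hM x hx).trans (le_max_left _ _)⟩

/-! ### The classes `𝒞`, `𝒞_I` and `𝒞_d` -/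

theorem partialT_neg {n : ℕ} (G : Sph n → ℝ → ℝ) (ξ : Sph n) (t : ℝ) :
    partialT (-G) ξ t = -partialT G ξ t :=
  deriv.neg

theorem ClassC.neg {n : ℕ} {G : Sph n → ℝ → ℝ} (hG : ClassC G) : ClassC (-G) where
  continuousOn := hG.continuousOn.neg
  differentiableAt ξ t ht := (hG.differentiableAt ξ t ht).neg
  continuousOn_partialT := by
    simp only [partialT_neg]
    exact hG.continuousOn_partialT.neg

theorem ClassCd.neg {n : ℕ} {G : Sph n → ℝ → ℝ} (hG : ClassCd G) : ClassCI (-G) :=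
  ⟨hG.1.neg, fun ξ t ht => by simpa [partialT_neg] using hG.2 ξ t ht⟩

theorem ClassC.comp_continuousOn {n : ℕ} {G : Sph n → ℝ → ℝ} (hG : ClassC G) {X : Type*}
    [TopologicalSpace X] {s : Set X} {u : X → Sph n} {r : X → ℝ} (hu : ContinuousOn u s)
    (hr : ContinuousOn r s) (hpos : ∀ x ∈ s, 0 < r x) : ContinuousOn (fun x => G (u x) (r x)) s :=
  hG.continuousOn.comp (f := fun x => (u x, r x)) (hu.prodMk hr)
    fun x hx => ⟨mem_univ _, hpos x hx⟩

theorem ClassC.partialT_comp_continuousOn {n : ℕ} {G : Sph n → ℝ → ℝ} (hG : ClassC G) {X : Type*}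
    [TopologicalSpace X] {s : Set X} {u : X → Sph n} {r : X → ℝ} (hu : ContinuousOn u s)
    (hr : ContinuousOn r s) (hpos : ∀ x ∈ s, 0 < r x) :
    ContinuousOn (fun x => partialT G (u x) (r x)) s :=
  hG.continuousOn_partialT.comp (f := fun x => (u x, r x)) (hu.prodMk hr)
    fun x hx => ⟨mem_univ _, hpos x hx⟩

theorem ClassC.continuousAt_partialT {n : ℕ} {G : Sph n → ℝ → ℝ} (hG : ClassC G) (ξ : Sph n)
    {t : ℝ} (ht : 0 < t) : ContinuousAt (fun p : Sph n × ℝ => partialT G p.1 p.2) (ξ, t) :=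
  hG.continuousOn_partialT.continuousAt
    ((isOpen_univ.prod isOpen_Ioi).mem_nhds ⟨mem_univ _, ht⟩)

theorem ClassCI.strictMonoOn {n : ℕ} {Ψ : Sph n → ℝ → ℝ} (hΨ : ClassCI Ψ) (ξ : Sph n) :
    StrictMonoOn (Ψ ξ) (Ioi 0) :=
  strictMonoOn_of_deriv_pos (convex_Ioi 0)
    (fun t ht => (hΨ.1.differentiableAt ξ t ht).continuousAt.continuousWithinAt)
    fun t ht => hΨ.2 ξ t (by simpa using ht)

theorem classC_of_CI_or_Cd {n : ℕ} {Ψ : Sph n → ℝ → ℝ} (hΨ : ClassCI Ψ ∨ ClassCd Ψ) : ClassC Ψ :=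
  hΨ.elim And.left And.left

theorem partialT_ne_zero {n : ℕ} {Ψ : Sph n → ℝ → ℝ} (hΨ : ClassCI Ψ ∨ ClassCd Ψ) (ξ : Sph n)
    {t : ℝ} (ht : 0 < t) : partialT Ψ ξ t ≠ 0 :=
  hΨ.elim (fun h => (h.2 ξ t ht).ne') fun h => (h.2 ξ t ht).ne

theorem injOn_of_CI_or_Cd {n : ℕ} {Ψ : Sph n → ℝ → ℝ} (hΨ : ClassCI Ψ ∨ ClassCd Ψ) (ξ : Sph n) :
    InjOn (Ψ ξ) (Ioi 0) := by
  rcases hΨ with h | h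
  · exact (h.strictMonoOn ξ).injOn
  · intro s hs t ht hst
    exact (h.neg.strictMonoOn ξ).injOn hs ht (by simpa using hst)

/-! ### Musielak-Orlicz addition -/

theorem ClassCI.exists_perturbation {n : ℕ} {Ψ : Sph n → ℝ → ℝ} (hΨ : ClassCI Ψ)
    {Ω : Set (Sph n)} (hΩ : IsCompact Ω) {f g : Sph n → ℝ} (hf : ContinuousOn f Ω)
    (hfpos : ∀ ξ ∈ Ω, 0 < f ξ) (hg : ContinuousOn g Ω) :
    ∃ a b δ : ℝ, 0 < a ∧ 0 < δ ∧ ∀ ε : ℝ, |ε| < δ → ∀ ξ ∈ Ω,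
      ∃ t ∈ Ioo a b, Ψ ξ t = Ψ ξ (f ξ) + ε * g ξ := by
  obtain ⟨m, hm, hmf⟩ := exists_pos_le_of_isCompact hΩ hf hfpos
  obtain ⟨M, hM, hfM⟩ := exists_abs_le_of_isCompact hΩ hf
  obtain ⟨B, hB, hgB⟩ := exists_abs_le_of_isCompact hΩ hg
  have hcf : ContinuousOn (fun ξ => Ψ ξ (f ξ)) Ω :=
    hΨ.1.comp_continuousOn continuousOn_id hf hfpos
  have hconst : ∀ t : ℝ, 0 < t → ContinuousOn (fun ξ => Ψ ξ t) Ω := fun t ht =>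
    hΨ.1.comp_continuousOn continuousOn_id continuousOn_const fun _ _ => ht
  have ha : 0 < m / 2 := by positivity
  have hb : 0 < M + 1 := by positivity
  obtain ⟨c, hc, hcl⟩ := exists_pos_le_of_isCompact hΩ (hcf.sub (hconst _ ha)) fun ξ hξ =>
    sub_pos.2 (hΨ.strictMonoOn ξ ha (hfpos ξ hξ) (by linarith [hmf ξ hξ]))
  obtain ⟨d, hd, hdl⟩ := exists_pos_le_of_isCompact hΩ ((hconst _ hb).sub hcf) fun ξ hξ =>
    sub_pos.2 (hΨ.strictMonoOn ξ (hfpos ξ hξ) hb (by linarith [le_abs_self (f ξ), hfM ξ hξ]))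
  refine ⟨m / 2, M + 1, min c d / (B + 1), ha, by positivity, fun ε hε ξ hξ => ?_⟩
  have h1 : |ε * g ξ| < min c d := by
    rw [lt_div_iff₀ (by positivity)] at hε
    rw [abs_mul]
    nlinarith [abs_nonneg ε, hgB ξ hξ, abs_nonneg (g ξ), hε, lt_min hc hd]
  obtain ⟨h2, h3⟩ := abs_lt.1 h1
  have h4 : c ≤ Ψ ξ (f ξ) - Ψ ξ (m / 2) := hcl ξ hξ
  have h5 : d ≤ Ψ ξ (M + 1) - Ψ ξ (f ξ) := hdl ξ hξ
  have h6 := min_le_left c d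
  have h7 := min_le_right c d
  have hab : m / 2 ≤ M + 1 := by linarith [le_abs_self (f ξ), hfM ξ hξ, hmf ξ hξ]
  exact intermediate_value_Ioo hab
    (fun t ht => (hΨ.1.differentiableAt ξ t (ha.trans_le ht.1)).continuousAt.continuousWithinAt)
    ⟨by linarith, by linarith⟩

theorem ClassCI.continuousOn_perturbation {n : ℕ} {Ψ : Sph n → ℝ → ℝ} (hΨ : ClassCI Ψ)
    {Ω : Set (Sph n)} {f g : Sph n → ℝ} (hf : ContinuousOn f Ω)
    (hfpos : ∀ ξ ∈ Ω, 0 < f ξ) (hg : ContinuousOn g Ω) {δ : ℝ} {F : ℝ → Sph n → ℝ}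
    (hF : ∀ ε : ℝ, |ε| < δ → ∀ ξ ∈ Ω, 0 < F ε ξ ∧ Ψ ξ (F ε ξ) = Ψ ξ (f ξ) + ε * g ξ) :
    ContinuousOn (fun p : ℝ × Sph n => F p.1 p.2) ({ε | |ε| < δ} ×ˢ Ω) := by
  set S : Set (ℝ × Sph n) := {ε | |ε| < δ} ×ˢ Ω
  have hsnd : MapsTo (Prod.snd : ℝ × Sph n → Sph n) S Ω := fun p hp => hp.2
  have hT : ContinuousOn (fun p : ℝ × Sph n => Ψ p.2 (f p.2) + p.1 * g p.2) S :=
    (hΨ.1.comp_continuousOn continuousOn_snd (hf.comp continuousOn_snd hsnd)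
      fun p hp => hfpos _ hp.2).add (continuousOn_fst.mul (hg.comp continuousOn_snd hsnd))
  have hconst : ∀ t : ℝ, 0 < t → ContinuousOn (fun p : ℝ × Sph n => Ψ p.2 t) S := fun t ht =>
    hΨ.1.comp_continuousOn continuousOn_snd continuousOn_const fun _ _ => ht
  intro p hp
  obtain ⟨hpos, heq⟩ := hF p.1 hp.1 p.2 hp.2
  refine tendsto_order.2 ⟨fun s hs => ?_, fun s hs => ?_⟩
  · have hs' : 0 < max s (F p.1 p.2 / 2) := lt_max_of_lt_right (by positivity)
    have hlt : max s (F p.1 p.2 / 2) < F p.1 p.2 := max_lt hs (by linarith)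
    have := hΨ.strictMonoOn p.2 hs' hpos hlt
    rw [heq] at this
    filter_upwards [((hconst _ hs') p hp).eventually_lt (hT p hp) this, self_mem_nhdsWithin]
      with q hq hqS
    obtain ⟨hqpos, hqeq⟩ := hF q.1 hqS.1 q.2 hqS.2
    rw [← hqeq] at hq
    exact (le_max_left _ _).trans_lt (((hΨ.strictMonoOn q.2).lt_iff_lt hs' hqpos).1 hq)
  · have hs' : 0 < s := hpos.trans hs
    have := hΨ.strictMonoOn p.2 hpos hs' hs
    rw [heq] at this
    filter_upwards [(hT p hp).eventually_lt ((hconst _ hs') p hp) this, self_mem_nhdsWithin]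
      with q hq hqS
    obtain ⟨hqpos, hqeq⟩ := hF q.1 hqS.1 q.2 hqS.2
    rw [← hqeq] at hq
    exact ((hΨ.strictMonoOn q.2).lt_iff_lt hqpos hs').1 hq

theorem exists_moAdd_bounds {n : ℕ} {Ψ : Sph n → ℝ → ℝ} (hΨ : ClassCI Ψ ∨ ClassCd Ψ)
    {Ω : Set (Sph n)} (hΩ : IsCompact Ω) {f g : Sph n → ℝ} (hf : ContinuousOn f Ω)
    (hfpos : ∀ ξ ∈ Ω, 0 < f ξ) (hg : ContinuousOn g Ω) :
    ∃ a b δ : ℝ, 0 < a ∧ 0 < δ ∧ ∀ ε : ℝ, |ε| < δ → ∀ ξ ∈ Ω,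
      moAdd Ψ f g ε ξ ∈ Ioo a b ∧ Ψ ξ (moAdd Ψ f g ε ξ) = Ψ ξ (f ξ) + ε * g ξ := by
  have hex : ∃ a b δ : ℝ, 0 < a ∧ 0 < δ ∧ ∀ ε : ℝ, |ε| < δ → ∀ ξ ∈ Ω,
      ∃ t ∈ Ioo a b, Ψ ξ t = Ψ ξ (f ξ) + ε * g ξ := by
    rcases hΨ with h | h
    · exact h.exists_perturbation hΩ hf hfpos hg
    · obtain ⟨a, b, δ, ha, hδ, H⟩ := h.neg.exists_perturbation hΩ hf hfpos hg.neg
      refine ⟨a, b, δ, ha, hδ, fun ε hε ξ hξ => ?_⟩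
      obtain ⟨t, ht, hteq⟩ := H ε hε ξ hξ
      refine ⟨t, ht, ?_⟩
      simp only [Pi.neg_apply] at hteq
      linarith
  obtain ⟨a, b, δ, ha, hδ, H⟩ := hex
  refine ⟨a, b, δ, ha, hδ, fun ε hε ξ hξ => ?_⟩
  obtain ⟨t, ht, hteq⟩ := H ε hε ξ hξ
  have htpos : t ∈ Ioi (0 : ℝ) := ha.trans ht.1
  have hsol : ∃ s ∈ Ioi (0 : ℝ), Ψ ξ s = Ψ ξ (f ξ) + ε * g ξ := ⟨t, htpos, hteq⟩
  have h1 : moAdd Ψ f g ε ξ ∈ Ioi (0 : ℝ) := Function.invFunOn_mem hsol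
  have h2 : Ψ ξ (moAdd Ψ f g ε ξ) = Ψ ξ (f ξ) + ε * g ξ := Function.invFunOn_eq hsol
  have h3 : moAdd Ψ f g ε ξ = t := injOn_of_CI_or_Cd hΨ ξ h1 htpos (h2.trans hteq.symm)
  exact ⟨h3 ▸ ht, h2⟩

theorem moAdd_zero {n : ℕ} {Ψ : Sph n → ℝ → ℝ} (hΨ : ClassCI Ψ ∨ ClassCd Ψ)
    (f g : Sph n → ℝ) {ξ : Sph n} (hξ : 0 < f ξ) : moAdd Ψ f g 0 ξ = f ξ := by
  have hsol : ∃ s ∈ Ioi (0 : ℝ), Ψ ξ s = Ψ ξ (f ξ) + 0 * g ξ := ⟨f ξ, hξ, by simp⟩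
  exact injOn_of_CI_or_Cd hΨ ξ (Function.invFunOn_mem hsol) hξ
    ((Function.invFunOn_eq hsol).trans (by simp))

theorem continuousOn_perturbation {n : ℕ} {Ψ : Sph n → ℝ → ℝ} (hΨ : ClassCI Ψ ∨ ClassCd Ψ)
    {Ω : Set (Sph n)} {f g : Sph n → ℝ} (hf : ContinuousOn f Ω)
    (hfpos : ∀ ξ ∈ Ω, 0 < f ξ) (hg : ContinuousOn g Ω) {δ : ℝ} {F : ℝ → Sph n → ℝ}
    (hF : ∀ ε : ℝ, |ε| < δ → ∀ ξ ∈ Ω, 0 < F ε ξ ∧ Ψ ξ (F ε ξ) = Ψ ξ (f ξ) + ε * g ξ) :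
    ContinuousOn (fun p : ℝ × Sph n => F p.1 p.2) ({ε | |ε| < δ} ×ˢ Ω) := by
  rcases hΨ with h | h
  · exact h.continuousOn_perturbation hf hfpos hg hF
  · refine h.neg.continuousOn_perturbation hf hfpos hg.neg fun ε hε ξ hξ => ?_
    obtain ⟨h1, h2⟩ := hF ε hε ξ hξ
    refine ⟨h1, ?_⟩
    simp only [Pi.neg_apply]
    linarith

/-- Cauchy's mean value theorem for a function and the logarithm. -/
theorem exists_log_sub_log_mul_eq {ψ : ℝ → ℝ} (hψ : ∀ t, 0 < t → DifferentiableAt ℝ ψ t)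
    {x y : ℝ} (hx : 0 < x) (hy : 0 < y) :
    ∃ s ∈ uIcc x y, (Real.log y - Real.log x) * (s * deriv ψ s) = ψ y - ψ x := by
  have key : ∀ {x y : ℝ}, 0 < x → x < y →
      ∃ s ∈ Icc x y, (Real.log y - Real.log x) * (s * deriv ψ s) = ψ y - ψ x := by
    intro x y hx hxy
    obtain ⟨s, hs, h⟩ := exists_ratio_deriv_eq_ratio_slope ψ hxy
      (fun t ht => (hψ t (hx.trans_le ht.1)).continuousAt.continuousWithinAt)
      (fun t ht => (hψ t (hx.trans ht.1)).differentiableWithinAt) Real.log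
      (fun t ht => (Real.continuousAt_log (hx.trans_le ht.1).ne').continuousWithinAt)
      (fun t ht => (Real.differentiableAt_log (hx.trans ht.1).ne').differentiableWithinAt)
    refine ⟨s, Ioo_subset_Icc_self hs, ?_⟩
    have hs0 : s ≠ 0 := (hx.trans hs.1).ne'
    rw [Real.deriv_log] at h
    rw [mul_left_comm, h]
    field_simp
  rcases lt_trichotomy x y with h | rfl | h
  · obtain ⟨s, hs, H⟩ := key hx h
    exact ⟨s, Icc_subset_uIcc hs, H⟩
  · exact ⟨x, left_mem_uIcc, by simp⟩
  · obtain ⟨s, hs, H⟩ := key hy h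
    exact ⟨s, Icc_subset_uIcc' hs, by linarith⟩

/-- The logarithm of the Musielak-Orlicz perturbation is differentiable at `ε = 0`, uniformly
on `Ω`. -/
theorem log_perturbation {n : ℕ} {Ψ : Sph n → ℝ → ℝ} (hΨ : ClassCI Ψ ∨ ClassCd Ψ)
    {Ω : Set (Sph n)} (hΩ : IsCompact Ω) {f g : Sph n → ℝ} (hf : ContinuousOn f Ω)
    (hfpos : ∀ ξ ∈ Ω, 0 < f ξ) (hg : ContinuousOn g Ω) {a b δ : ℝ} (ha : 0 < a) (hδ : 0 < δ)
    {F : ℝ → Sph n → ℝ} (hfab : ∀ ξ ∈ Ω, f ξ ∈ Ioo a b)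
    (hF : ∀ ε : ℝ, |ε| < δ → ∀ ξ ∈ Ω, F ε ξ ∈ Ioo a b ∧ Ψ ξ (F ε ξ) = Ψ ξ (f ξ) + ε * g ξ) :
    (∃ M, 0 ≤ M ∧ ∀ ε : ℝ, |ε| < δ → ∀ ξ ∈ Ω,
      |Real.log (F ε ξ) - Real.log (f ξ)| ≤ M * |ε|) ∧
    ∀ η ∈ Ω, Tendsto (fun p : ℝ × Sph n => (Real.log (F p.1 p.2) - Real.log (f p.2)) / p.1)
      (𝓝[≠] 0 ×ˢ 𝓝[Ω] η) (𝓝 (g η / (f η * partialT Ψ η (f η)))) := by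
  have hC := classC_of_CI_or_Cd hΨ
  have h0 : |(0 : ℝ)| < δ := by simpa using hδ
  have hpos : ∀ ε : ℝ, |ε| < δ → ∀ ξ ∈ Ω, 0 < F ε ξ := fun ε hε ξ hξ =>
    ha.trans (hF ε hε ξ hξ).1.1
  have hex : ∀ ε : ℝ, ∀ ξ : Sph n, ∃ s : ℝ, |ε| < δ → ξ ∈ Ω → s ∈ uIcc (f ξ) (F ε ξ) ∧
      (Real.log (F ε ξ) - Real.log (f ξ)) * (s * partialT Ψ ξ s) = ε * g ξ := by
    intro ε ξ
    by_cases hε : |ε| < δ ∧ ξ ∈ Ω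
    · obtain ⟨s, hs, H⟩ := exists_log_sub_log_mul_eq (hC.differentiableAt ξ)
        (hfpos ξ hε.2) (hpos ε hε.1 ξ hε.2)
      refine ⟨s, fun _ _ => ⟨hs, ?_⟩⟩
      rw [partialT, H, (hF ε hε.1 ξ hε.2).2]
      ring
    · exact ⟨0, fun h1 h2 => absurd ⟨h1, h2⟩ hε⟩
  choose s hs using hex
  refine ⟨?_, fun η hη => ?_⟩
  · obtain ⟨B, hB, hgB⟩ := exists_abs_le_of_isCompact hΩ hg
    obtain ⟨c, hc, hcl⟩ := exists_pos_le_of_isCompact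
      (s := (univ : Set (Sph n)) ×ˢ Icc a b) (isCompact_univ.prod isCompact_Icc)
      (f := fun p => |p.2 * partialT Ψ p.1 p.2|)
      (continuousOn_snd.mul (hC.continuousOn_partialT.mono
        (prod_mono_right fun t ht => ha.trans_le ht.1))).abs
      fun p hp => abs_pos.2 (mul_ne_zero (ha.trans_le hp.2.1).ne'
        (partialT_ne_zero hΨ _ (ha.trans_le hp.2.1)))
    refine ⟨B / c, by positivity, fun ε hε ξ hξ => ?_⟩
    obtain ⟨h1, h2⟩ := hs ε ξ hε hξ
    have h3 : s ε ξ ∈ Icc a b := by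
      have hsub : uIcc (f ξ) (F ε ξ) ⊆ Icc a b := uIcc_subset_Icc
        (Ioo_subset_Icc_self (hfab ξ hξ)) (Ioo_subset_Icc_self (hF ε hε ξ hξ).1)
      exact hsub h1
    have h4 := hcl (ξ, s ε ξ) ⟨mem_univ _, h3⟩
    simp only at h4
    rw [div_mul_eq_mul_div, le_div_iff₀ hc]
    calc |Real.log (F ε ξ) - Real.log (f ξ)| * c
        ≤ |Real.log (F ε ξ) - Real.log (f ξ)| * |s ε ξ * partialT Ψ ξ (s ε ξ)| := by gcongr
      _ = |ε| * |g ξ| := by rw [← abs_mul, h2, abs_mul]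
      _ ≤ B * |ε| := by rw [mul_comm]; gcongr; exact hgB ξ hξ
  · have hcont : ContinuousOn (fun p : ℝ × Sph n => F p.1 p.2) ({ε | |ε| < δ} ×ˢ Ω) :=
      continuousOn_perturbation hΨ hf hfpos hg fun ε hε ξ hξ =>
        ⟨hpos ε hε ξ hξ, (hF ε hε ξ hξ).2⟩
    have hδmem : {ε : ℝ | |ε| < δ} ∈ 𝓝 (0 : ℝ) :=
      (isOpen_lt continuous_abs continuous_const).mem_nhds h0
    have hev : ∀ᶠ p : ℝ × Sph n in 𝓝[≠] 0 ×ˢ 𝓝[Ω] η, p.1 ≠ 0 ∧ |p.1| < δ ∧ p.2 ∈ Ω := by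
      filter_upwards [prod_mem_prod (inter_mem self_mem_nhdsWithin
        (mem_nhdsWithin_of_mem_nhds hδmem)) self_mem_nhdsWithin] with p hp
      exact ⟨hp.1.1, hp.1.2, hp.2⟩
    have hle : 𝓝[≠] (0 : ℝ) ×ˢ 𝓝[Ω] η ≤ 𝓝[{ε : ℝ | |ε| < δ} ×ˢ Ω] (0, η) := by
      rw [nhdsWithin_prod_eq, nhdsWithin_eq_nhds.2 hδmem]
      exact prod_mono nhdsWithin_le_nhds le_rfl
    have hT1 : Tendsto (fun p : ℝ × Sph n => F p.1 p.2) (𝓝[≠] 0 ×ˢ 𝓝[Ω] η) (𝓝 (f η)) := by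
      have hF0 : F 0 η = f η := injOn_of_CI_or_Cd hΨ η (hpos 0 h0 η hη) (hfpos η hη)
        (by simpa using (hF 0 h0 η hη).2)
      rw [← hF0]
      exact (hcont (0, η) ⟨h0, hη⟩).mono_left hle
    have hsnd : Tendsto (Prod.snd : ℝ × Sph n → Sph n) (𝓝[≠] 0 ×ˢ 𝓝[Ω] η) (𝓝[Ω] η) :=
      tendsto_snd
    have hT0 : Tendsto (fun p : ℝ × Sph n => f p.2) (𝓝[≠] 0 ×ˢ 𝓝[Ω] η) (𝓝 (f η)) :=
      (hf η hη).tendsto.comp hsnd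
    have hTs : Tendsto (fun p : ℝ × Sph n => s p.1 p.2) (𝓝[≠] 0 ×ˢ 𝓝[Ω] η) (𝓝 (f η)) := by
      refine tendsto_of_tendsto_of_tendsto_of_le_of_le' (by simpa using hT0.min hT1)
        (by simpa using hT0.max hT1) ?_ ?_ <;>
      filter_upwards [hev] with p hp
      exacts [(hs p.1 p.2 hp.2.1 hp.2.2).1.1, (hs p.1 p.2 hp.2.1 hp.2.2).1.2]
    have hTΨ : Tendsto (fun p : ℝ × Sph n => partialT Ψ p.2 (s p.1 p.2)) (𝓝[≠] 0 ×ˢ 𝓝[Ω] η)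
        (𝓝 (partialT Ψ η (f η))) :=
      (hC.continuousAt_partialT η (hfpos η hη)).tendsto.comp
        ((hsnd.mono_right nhdsWithin_le_nhds).prodMk_nhds hTs)
    have hne : f η * partialT Ψ η (f η) ≠ 0 :=
      mul_ne_zero (hfpos η hη).ne' (partialT_ne_zero hΨ _ (hfpos η hη))
    refine (((hg η hη).tendsto.comp hsnd).div (hTs.mul hTΨ) hne).congr' ?_
    filter_upwards [hev] with p hp
    obtain ⟨h1, h2⟩ := hs p.1 p.2 hp.2.1 hp.2.2
    have hspos : 0 < s p.1 p.2 :=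
      (lt_min (hfpos p.2 hp.2.2) (hpos p.1 hp.2.1 p.2 hp.2.2)).trans_le h1.1
    simp only [Function.comp_apply, Pi.div_apply]
    rw [div_eq_div_iff (mul_ne_zero hspos.ne' (partialT_ne_zero hΨ _ hspos)) hp.1, h2, mul_comm]

/-! ### The gauge of a Wulff shape -/

/-- Positive continuous functions on a nonempty compact set of directions that is not contained in a
closed hemisphere. -/
structure IsWulffGenerator {n : ℕ} (Ω : Set (Sph n)) (k : Sph n → ℝ) : Prop where
  isCompact : IsCompact Ω
  nonempty : Ω.Nonempty
  not_inClosedHemisphere : ¬ InClosedHemisphere Ω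
  continuousOn : ContinuousOn k Ω
  pos : ∀ η ∈ Ω, 0 < k η

/-- The gauge of the Wulff shape `[k]`. -/
def wulffGauge {n : ℕ} (Ω : Set (Sph n)) (k : Sph n → ℝ) (x : Rn n) : ℝ :=
  sSup ((fun η : Sph n => inner ℝ x (η : Rn n) / k η) '' Ω)

namespace IsWulffGenerator

variable {n : ℕ} {Ω : Set (Sph n)} {k : Sph n → ℝ}

theorem continuousOn_inner_div (h : IsWulffGenerator Ω k) (x : Rn n) :
    ContinuousOn (fun η : Sph n => inner ℝ x (η : Rn n) / k η) Ω :=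
  (Continuous.continuousOn (by fun_prop)).div h.continuousOn fun η hη => (h.pos η hη).ne'

theorem inner_div_le_gauge (h : IsWulffGenerator Ω k) (x : Rn n) {η : Sph n} (hη : η ∈ Ω) :
    inner ℝ x (η : Rn n) / k η ≤ wulffGauge Ω k x :=
  le_csSup (h.isCompact.image_of_continuousOn (h.continuousOn_inner_div x)).bddAbove
    (mem_image_of_mem _ hη)

theorem gauge_le (h : IsWulffGenerator Ω k) {x : Rn n} {c : ℝ}
    (hc : ∀ η ∈ Ω, inner ℝ x (η : Rn n) / k η ≤ c) : wulffGauge Ω k x ≤ c :=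
  csSup_le (h.nonempty.image _) (forall_mem_image.2 hc)

theorem exists_gauge_eq (h : IsWulffGenerator Ω k) (x : Rn n) :
    ∃ η ∈ Ω, inner ℝ x (η : Rn n) / k η = wulffGauge Ω k x := by
  obtain ⟨η, hη, hmax⟩ := h.isCompact.exists_isMaxOn h.nonempty (h.continuousOn_inner_div x)
  exact ⟨η, hη, le_antisymm (h.inner_div_le_gauge x hη) (h.gauge_le fun η' hη' => hmax hη')⟩

theorem gauge_smul (h : IsWulffGenerator Ω k) {t : ℝ} (ht : 0 ≤ t) (x : Rn n) :
    wulffGauge Ω k (t • x) = t * wulffGauge Ω k x := by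
  have hsm : ∀ η : Sph n, inner ℝ (t • x) (η : Rn n) / k η = t * (inner ℝ x (η : Rn n) / k η) :=
    fun η => by rw [real_inner_smul_left, mul_div_assoc]
  apply le_antisymm
  · refine h.gauge_le fun η hη => ?_
    rw [hsm]
    exact mul_le_mul_of_nonneg_left (h.inner_div_le_gauge x hη) ht
  · obtain ⟨η, hη, heq⟩ := h.exists_gauge_eq x
    rw [← heq, ← hsm]
    exact h.inner_div_le_gauge _ hη

theorem exists_lipschitzWith_gauge (h : IsWulffGenerator Ω k) :
    ∃ C : NNReal, LipschitzWith C (wulffGauge Ω k) := by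
  obtain ⟨m, hm, hmk⟩ := exists_pos_le_of_isCompact h.isCompact h.continuousOn h.pos
  refine ⟨⟨m⁻¹, by positivity⟩, LipschitzWith.of_le_add_mul _ fun x y => h.gauge_le fun η hη => ?_⟩
  have h1 : inner ℝ x (η : Rn n) / k η =
      inner ℝ y (η : Rn n) / k η + inner ℝ (x - y) (η : Rn n) / k η := by
    rw [inner_sub_left]
    ring
  have h2 : inner ℝ (x - y) (η : Rn n) ≤ dist x y := by
    have := real_inner_le_norm (x - y) (η : Rn n)
    rwa [norm_eq_of_mem_sphere, mul_one, ← dist_eq_norm] at this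
  have h3 : inner ℝ (x - y) (η : Rn n) / k η ≤ m⁻¹ * dist x y := by
    rw [div_le_iff₀ (h.pos η hη)]
    have : 1 ≤ m⁻¹ * k η := by
      rw [← inv_mul_cancel₀ hm.ne']
      gcongr
      exact hmk η hη
    nlinarith [dist_nonneg (x := x) (y := y)]
  rw [h1]
  exact add_le_add (h.inner_div_le_gauge y hη) h3

theorem continuous_gauge (h : IsWulffGenerator Ω k) : Continuous (wulffGauge Ω k) :=
  h.exists_lipschitzWith_gauge.choose_spec.continuous

theorem gauge_pos (h : IsWulffGenerator Ω k) (ξ : Sph n) : 0 < wulffGauge Ω k ξ := by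
  have hne := h.not_inClosedHemisphere
  simp only [InClosedHemisphere, not_exists, not_forall, not_le] at hne
  obtain ⟨η, hη, hlt⟩ := hne (-ξ)
  refine lt_of_lt_of_le (div_pos ?_ (h.pos η hη)) (h.inner_div_le_gauge _ hη)
  simpa using hlt

theorem exists_mul_norm_le_gauge (h : IsWulffGenerator Ω k) :
    ∃ c, 0 < c ∧ ∀ x : Rn n, c * ‖x‖ ≤ wulffGauge Ω k x := by
  obtain ⟨c, hc, hle⟩ := exists_pos_le_of_isCompact (s := (univ : Set (Sph n))) isCompact_univ
    (h.continuous_gauge.comp continuous_subtype_val).continuousOn fun ξ _ => h.gauge_pos ξ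
  refine ⟨c, hc, fun x => ?_⟩
  rcases eq_or_ne x 0 with rfl | hx
  · have := h.gauge_smul le_rfl (0 : Rn n)
    rw [zero_smul, zero_mul] at this
    simp [this]
  · have hx' : ‖x‖ ≠ 0 := norm_ne_zero_iff.2 hx
    have h1 := hle ⟨‖x‖⁻¹ • x, by simp [norm_smul, hx']⟩ (mem_univ _)
    simp only [Function.comp_apply] at h1
    rw [h.gauge_smul (by positivity)] at h1
    rwa [← le_div_iff₀ (by positivity), div_eq_inv_mul]

theorem mem_wulff (h : IsWulffGenerator Ω k) {x : Rn n} :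
    x ∈ wulff Ω k ↔ wulffGauge Ω k x ≤ 1 := by
  simp only [wulff, mem_iInter, mem_ofPred_eq]
  constructor
  · exact fun hx => h.gauge_le fun η hη => (div_le_one (h.pos η hη)).2 (hx η hη)
  · exact fun hx η hη => (div_le_one (h.pos η hη)).1 ((h.inner_div_le_gauge x hη).trans hx)

theorem radialFn_wulff (h : IsWulffGenerator Ω k) (ξ : Sph n) :
    radialFn (wulff Ω k) ξ = (wulffGauge Ω k ξ)⁻¹ := by
  have hpos := h.gauge_pos ξ
  have : {r : ℝ | 0 ≤ r ∧ r • (ξ : Rn n) ∈ wulff Ω k} = Icc 0 (wulffGauge Ω k ξ)⁻¹ := by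
    ext r
    refine and_congr_right fun hr => ?_
    rw [h.mem_wulff, h.gauge_smul hr, ← one_div, le_div_iff₀ hpos]
  rw [radialFn, this, csSup_Icc (by positivity)]

theorem radialFn_wulff_pos (h : IsWulffGenerator Ω k) (ξ : Sph n) :
    0 < radialFn (wulff Ω k) ξ := by
  rw [h.radialFn_wulff]
  exact inv_pos.2 (h.gauge_pos ξ)

theorem continuous_radialFn_wulff (h : IsWulffGenerator Ω k) :
    Continuous fun ξ : Sph n => radialFn (wulff Ω k) ξ := by
  simp only [h.radialFn_wulff]
  exact (h.continuous_gauge.comp continuous_subtype_val).inv₀ fun ξ => (h.gauge_pos ξ).ne'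

/-! ### The support function of a Wulff shape -/

theorem exists_norm_le_of_mem_wulff (h : IsWulffGenerator Ω k) :
    ∃ R : NNReal, ∀ y ∈ wulff Ω k, ‖y‖ ≤ R := by
  obtain ⟨c, hc, hle⟩ := h.exists_mul_norm_le_gauge
  refine ⟨⟨c⁻¹, by positivity⟩, fun y hy => ?_⟩
  have := (hle y).trans (h.mem_wulff.1 hy)
  change ‖y‖ ≤ c⁻¹
  rwa [← one_div, le_div_iff₀ hc, mul_comm]

theorem zero_mem_wulff (h : IsWulffGenerator Ω k) : (0 : Rn n) ∈ wulff Ω k := by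
  simp only [wulff, mem_iInter, mem_ofPred_eq, inner_zero_left]
  exact fun η hη => (h.pos η hη).le

theorem inner_le_supportFn (h : IsWulffGenerator Ω k) (x : Rn n) {y : Rn n}
    (hy : y ∈ wulff Ω k) : inner ℝ x y ≤ supportFn (wulff Ω k) x := by
  obtain ⟨R, hR⟩ := h.exists_norm_le_of_mem_wulff
  refine le_csSup ⟨‖x‖ * R, forall_mem_image.2 fun z hz => ?_⟩ (mem_image_of_mem _ hy)
  exact (real_inner_le_norm x z).trans (mul_le_mul_of_nonneg_left (hR z hz) (norm_nonneg _))

theorem supportFn_le (h : IsWulffGenerator Ω k) {x : Rn n} {c : ℝ}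
    (hc : ∀ y ∈ wulff Ω k, inner ℝ x y ≤ c) : supportFn (wulff Ω k) x ≤ c :=
  csSup_le (Nonempty.image _ ⟨0, h.zero_mem_wulff⟩) (forall_mem_image.2 hc)

theorem continuous_supportFn (h : IsWulffGenerator Ω k) :
    Continuous (supportFn (wulff Ω k)) := by
  obtain ⟨R, hR⟩ := h.exists_norm_le_of_mem_wulff
  refine (LipschitzWith.of_le_add_mul R fun x x' => h.supportFn_le fun y hy => ?_).continuous
  have h1 : inner ℝ x y = inner ℝ x' y + inner ℝ (x - x') y := by
    rw [inner_sub_left]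
    ring
  have h2 : inner ℝ (x - x') y ≤ R * dist x x' := by
    rw [dist_eq_norm, mul_comm]
    exact (real_inner_le_norm _ _).trans
      (mul_le_mul_of_nonneg_left (hR y hy) (norm_nonneg _))
  rw [h1]
  exact add_le_add (h.inner_le_supportFn x' hy) h2

theorem radialFn_smul_mem_wulff (h : IsWulffGenerator Ω k) (ξ : Sph n) :
    radialFn (wulff Ω k) ξ • (ξ : Rn n) ∈ wulff Ω k := by
  rw [h.mem_wulff, h.gauge_smul (h.radialFn_wulff_pos ξ).le, h.radialFn_wulff,
    inv_mul_cancel₀ (h.gauge_pos ξ).ne']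

theorem supportFn_pos (h : IsWulffGenerator Ω k) (u : Sph n) :
    0 < supportFn (wulff Ω k) u := by
  refine (h.radialFn_wulff_pos u).trans_le ?_
  have := h.inner_le_supportFn (u : Rn n) (h.radialFn_smul_mem_wulff u)
  rwa [real_inner_smul_right, real_inner_self_eq_norm_sq, norm_eq_of_mem_sphere, one_pow,
    mul_one] at this

theorem supportFn_le_apply (h : IsWulffGenerator Ω k) {η : Sph n} (hη : η ∈ Ω) :
    supportFn (wulff Ω k) η ≤ k η := by
  refine h.supportFn_le fun y hy => ?_
  rw [real_inner_comm]
  simp only [wulff, mem_iInter, mem_ofPred_eq] at hy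
  exact hy η hη

theorem inner_le_gauge_mul_supportFn (h : IsWulffGenerator Ω k) (x u : Rn n) :
    inner ℝ x u ≤ wulffGauge Ω k x * supportFn (wulff Ω k) u := by
  obtain ⟨c, hc, hle⟩ := h.exists_mul_norm_le_gauge
  rcases eq_or_ne x 0 with rfl | hx
  · have := h.gauge_smul le_rfl (0 : Rn n)
    rw [zero_smul, zero_mul] at this
    simp [this]
  · have hpos : 0 < wulffGauge Ω k x := (mul_pos hc (norm_pos_iff.2 hx)).trans_le (hle x)
    have hmem : (wulffGauge Ω k x)⁻¹ • x ∈ wulff Ω k := by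
      rw [h.mem_wulff, h.gauge_smul (by positivity), inv_mul_cancel₀ hpos.ne']
    have := h.inner_le_supportFn u hmem
    rw [real_inner_smul_right, real_inner_comm] at this
    rwa [inv_mul_le_iff₀ hpos] at this

theorem radialFn_polarBody_wulff (h : IsWulffGenerator Ω k) (u : Sph n) :
    radialFn (polarBody (wulff Ω k)) u = (supportFn (wulff Ω k) u)⁻¹ := by
  have hpos := h.supportFn_pos u
  have : {r : ℝ | 0 ≤ r ∧ r • (u : Rn n) ∈ polarBody (wulff Ω k)} =
      Icc 0 (supportFn (wulff Ω k) u)⁻¹ := by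
    ext r
    refine and_congr_right fun hr => ?_
    rw [← one_div, le_div_iff₀ hpos]
    simp only [polarBody, mem_ofPred_eq, real_inner_smul_left]
    constructor
    · intro H
      rcases hr.eq_or_lt with rfl | hr
      · simp
      · rw [← le_div_iff₀' hr]
        exact h.supportFn_le fun y hy => (le_div_iff₀' hr).2 (H y hy)
    · exact fun H y hy => (mul_le_mul_of_nonneg_left (h.inner_le_supportFn _ hy) hr).trans H
  rw [radialFn, this, csSup_Icc (by positivity)]

/-! ### The radial Gauss image of a Wulff shape -/

theorem mem_radialGaussImage (h : IsWulffGenerator Ω k) {ξ u : Sph n} :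
    u ∈ radialGaussImage (wulff Ω k) ξ ↔
      inner ℝ (ξ : Rn n) (u : Rn n) = wulffGauge Ω k ξ * supportFn (wulff Ω k) u := by
  rw [radialGaussImage, mem_ofPred_eq, real_inner_smul_left, h.radialFn_wulff,
    inv_mul_eq_iff_eq_mul₀ (h.gauge_pos ξ).ne']

theorem mem_radialGaussImage_of_gauge_eq (h : IsWulffGenerator Ω k) {ξ η : Sph n} (hη : η ∈ Ω)
    (heq : inner ℝ (ξ : Rn n) (η : Rn n) / k η = wulffGauge Ω k ξ) :
    η ∈ radialGaussImage (wulff Ω k) ξ ∧ supportFn (wulff Ω k) η = k η := by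
  have hk : supportFn (wulff Ω k) η = k η := by
    refine (h.supportFn_le_apply hη).antisymm ?_
    have h1 := h.inner_le_gauge_mul_supportFn (ξ : Rn n) (η : Rn n)
    rw [div_eq_iff (h.pos η hη).ne'] at heq
    rw [heq] at h1
    exact le_of_mul_le_mul_left h1 (h.gauge_pos ξ)
  refine ⟨?_, hk⟩
  rw [h.mem_radialGaussImage, hk, ← heq, div_mul_cancel₀ _ (h.pos η hη).ne']

/-- Where the gauge is differentiable, every outer normal is a multiple of its gradient. -/
theorem eq_smul_gradient (h : IsWulffGenerator Ω k) {ξ u : Sph n}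
    (hd : DifferentiableAt ℝ (wulffGauge Ω k) ξ) (hu : u ∈ radialGaussImage (wulff Ω k) ξ) :
    (u : Rn n) = supportFn (wulff Ω k) u • gradient (wulffGauge Ω k) ξ := by
  have hpos := h.supportFn_pos u
  set L : Rn n →L[ℝ] ℝ := innerSL ℝ (u : Rn n)
  have hmin : IsLocalMin
      (fun x : Rn n => supportFn (wulff Ω k) u * wulffGauge Ω k x - L x) ξ := by
    refine Eventually.of_forall fun x => ?_
    have h1 := h.inner_le_gauge_mul_supportFn x (u : Rn n)
    have h2 := h.mem_radialGaussImage.1 hu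
    rw [real_inner_comm] at h1 h2
    simp only [L, innerSL_apply_apply]
    linarith
  have hder := ((hd.hasFDerivAt.const_mul (supportFn (wulff Ω k) u)).sub
    L.hasFDerivAt).fderiv.symm.trans hmin.fderiv_eq_zero
  refine ext_inner_right ℝ fun v => ?_
  have h3 := DFunLike.congr_fun hder v
  simp only [L, sub_apply, smul_apply,
    innerSL_apply_apply, smul_eq_mul, zero_apply] at h3
  rw [real_inner_smul_left, gradient, InnerProductSpace.toDual_symm_apply]
  linarith

end IsWulffGenerator

/-- The normalized gradient of a function at a point of the sphere. -/
def unitGradient {n : ℕ} (N : Rn n → ℝ) (ξ : Sph n) : Sph n :=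
  open Classical in
  if h : gradient N ξ = 0 then ξ else ⟨‖gradient N ξ‖⁻¹ • gradient N ξ, by simp [norm_smul, h]⟩

theorem coe_unitGradient {n : ℕ} {N : Rn n → ℝ} {ξ : Sph n} (h : gradient N (ξ : Rn n) ≠ 0) :
    (unitGradient N ξ : Rn n) = ‖gradient N (ξ : Rn n)‖⁻¹ • gradient N (ξ : Rn n) := by
  rw [unitGradient, dif_neg h]

theorem measurable_unitGradient {n : ℕ} (N : Rn n → ℝ) : Measurable (unitGradient N) := by
  classical
  have hg : Measurable fun ξ : Sph n => gradient N (ξ : Rn n) :=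
    (((InnerProductSpace.toDual ℝ (Rn n)).symm.continuous.measurable).comp
      (measurable_fderiv ℝ N)).comp measurable_subtype_coe
  have heq : (fun ξ : Sph n => (unitGradient N ξ : Rn n)) = fun ξ : Sph n =>
      if gradient N (ξ : Rn n) = 0 then (ξ : Rn n) else
        ‖gradient N (ξ : Rn n)‖⁻¹ • gradient N (ξ : Rn n) := by
    ext1 ξ
    split_ifs with h
    · rw [unitGradient, dif_pos h]
    · exact coe_unitGradient h
  refine (MeasurableEmbedding.subtype_coe Metric.isClosed_sphere.measurableSet).measurable_comp_iff.1 ?_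
  change Measurable (fun ξ : Sph n => (unitGradient N ξ : Rn n))
  rw [heq]
  exact Measurable.ite (hg (measurableSet_singleton 0)) measurable_subtype_coe
    (hg.norm.inv.smul hg)

namespace IsWulffGenerator

variable {n : ℕ} {Ω : Set (Sph n)} {k : Sph n → ℝ}

theorem eq_unitGradient (h : IsWulffGenerator Ω k) {ξ u : Sph n}
    (hd : DifferentiableAt ℝ (wulffGauge Ω k) ξ) (hu : u ∈ radialGaussImage (wulff Ω k) ξ) :
    u = unitGradient (wulffGauge Ω k) ξ := by
  have hpos := h.supportFn_pos u
  have h1 := h.eq_smul_gradient hd hu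
  have hnorm : supportFn (wulff Ω k) u * ‖gradient (wulffGauge Ω k) (ξ : Rn n)‖ = 1 := by
    have h2 : ‖(u : Rn n)‖ = 1 := norm_eq_of_mem_sphere u
    have h3 := congrArg norm h1
    rwa [norm_smul, Real.norm_of_nonneg hpos.le, h2, eq_comm] at h3
  have hne : gradient (wulffGauge Ω k) (ξ : Rn n) ≠ 0 := by
    intro h0
    simp [h0] at hnorm
  ext1
  rw [coe_unitGradient hne, ← eq_inv_of_mul_eq_one_left hnorm, ← h1]

/-- Almost every direction has exactly one outer normal; it lies in `Ω`, and it is the only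
maximizer in the definition of the gauge. -/
theorem ae_radialGaussImage_eq (h : IsWulffGenerator Ω k) :
    ∀ᵐ ξ : Sph n ∂sphMeasure n,
      radialGaussImage (wulff Ω k) ξ = {unitGradient (wulffGauge Ω k) ξ} ∧
      unitGradient (wulffGauge Ω k) ξ ∈ Ω ∧
      supportFn (wulff Ω k) (unitGradient (wulffGauge Ω k) ξ) =
        k (unitGradient (wulffGauge Ω k) ξ) ∧
      ∀ η ∈ Ω, inner ℝ (ξ : Rn n) (η : Rn n) / k η = wulffGauge Ω k ξ →
        η = unitGradient (wulffGauge Ω k) ξ := by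
  obtain ⟨C, hC⟩ := h.exists_lipschitzWith_gauge
  filter_upwards [ae_sphMeasure_differentiableAt hC fun t ht x => h.gauge_smul ht x] with ξ hd
  obtain ⟨η, hη, heq⟩ := h.exists_gauge_eq (ξ : Rn n)
  obtain ⟨hmem, hk⟩ := h.mem_radialGaussImage_of_gauge_eq hη heq
  obtain rfl := h.eq_unitGradient hd hmem
  exact ⟨eq_singleton_iff_unique_mem.2 ⟨hmem, fun u hu => h.eq_unitGradient hd hu⟩, hη, hk,
    fun η' hη' heq' =>
      h.eq_unitGradient hd (h.mem_radialGaussImage_of_gauge_eq hη' heq').1⟩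

end IsWulffGenerator

theorem radialGaussMap_eq_of_eq_singleton {n : ℕ} {K : Set (Rn n)} {ξ u : Sph n}
    (h : radialGaussImage K ξ = {u}) : radialGaussMap K ξ = u := by
  have hne : (radialGaussImage K ξ).Nonempty := h ▸ singleton_nonempty u
  rw [radialGaussMap, dif_pos hne]
  exact mem_singleton_iff.1 (h ▸ hne.some_mem)

theorem mem_revRadialGaussImage_iff_of_eq_singleton {n : ℕ} {K : Set (Rn n)} {ξ u : Sph n}
    (h : radialGaussImage K ξ = {u}) (ω : Set (Sph n)) :
    ξ ∈ revRadialGaussImage K ω ↔ u ∈ ω := by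
  have h1 : ξ ∈ revRadialGaussImage K ω ↔ ∃ v ∈ ω, v ∈ radialGaussImage K ξ := Iff.rfl
  rw [h1, h]
  simp

theorem polarBody_hull {n : ℕ} {Ω : Set (Sph n)} {f : Sph n → ℝ} (hf : ∀ ξ ∈ Ω, 0 < f ξ) :
    polarBody (hull Ω f) = wulff Ω fun ξ => (f ξ)⁻¹ := by
  ext x
  simp only [polarBody, wulff, mem_iInter, mem_ofPred_eq]
  constructor
  · intro hx ξ hξ
    have := hx (f ξ • (ξ : Rn n)) (subset_closedConvexHull (mem_image_of_mem _ hξ))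
    rwa [real_inner_smul_right, ← le_div_iff₀' (hf ξ hξ), one_div] at this
  · intro hx
    have hsub : hull Ω f ⊆ {y : Rn n | innerSL ℝ x y ≤ 1} := by
      refine closedConvexHull_min ?_ (convex_halfSpace_le (innerSL ℝ x).isLinear 1)
        (isClosed_le (innerSL ℝ x).continuous continuous_const)
      rintro _ ⟨ξ, hξ, rfl⟩
      simp only [mem_ofPred_eq, innerSL_apply_apply]
      rw [real_inner_smul_right, ← le_div_iff₀' (hf ξ hξ), one_div]
      exact hx ξ hξ
    exact fun y hy => hsub hy

namespace IsWulffGenerator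

variable {n : ℕ} {Ω : Set (Sph n)} {k : Sph n → ℝ}

/-! ### Gauss image measures of a Wulff shape -/

theorem exists_gaussImageMeasure (h : IsWulffGenerator Ω k) {lam : Measure (Sph n)}
    [IsFiniteMeasure lam] (hlam : lam ≪ sphMeasure n) {J w D : Sph n → ℝ} (hJ : Continuous J)
    (hw : Continuous w) (hD : ∀ ξ, D ξ = J ξ * w (radialGaussMap (wulff Ω k) ξ)) :
    ∃ C : SignedMeasure (Sph n),
      (∀ ω : Set (Sph n), MeasurableSet ω →
        NullMeasurableSet (revRadialGaussImage (wulff Ω k) ω) lam ∧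
        IntegrableOn D (revRadialGaussImage (wulff Ω k) ω) lam ∧
        C ω = ∫ ξ in revRadialGaussImage (wulff Ω k) ω, D ξ ∂lam) ∧
      ∀ g : Sph n → ℝ, ContinuousOn g Ω → ∫ᵛ u in Ω, g u ∂•C =
        ∫ ξ, J ξ * w (unitGradient (wulffGauge Ω k) ξ) *
          g (unitGradient (wulffGauge Ω k) ξ) ∂lam := by
  set A := unitGradient (wulffGauge Ω k)
  have hA : Measurable A := measurable_unitGradient _
  have hae := hlam.ae_le h.ae_radialGaussImage_eq
  have hmeas : Measurable fun ξ => J ξ * w (A ξ) := hJ.measurable.mul (hw.measurable.comp hA)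
  obtain ⟨M, hM, hJM⟩ := exists_abs_le_of_isCompact (isCompact_univ (X := Sph n)) hJ.continuousOn
  obtain ⟨M', hM', hwM⟩ := exists_abs_le_of_isCompact (isCompact_univ (X := Sph n)) hw.continuousOn
  have hint : Integrable (fun ξ => J ξ * w (A ξ)) lam := by
    refine Integrable.of_bound hmeas.aestronglyMeasurable (M * M') (Eventually.of_forall fun ξ => ?_)
    rw [Real.norm_eq_abs, abs_mul]
    exact mul_le_mul (hJM _ (mem_univ _)) (hwM _ (mem_univ _)) (abs_nonneg _) hM
  have hDae : D =ᵐ[lam] fun ξ => J ξ * w (A ξ) := by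
    filter_upwards [hae] with ξ hξ
    rw [hD, radialGaussMap_eq_of_eq_singleton hξ.1]
  have hset : ∀ ω : Set (Sph n), revRadialGaussImage (wulff Ω k) ω =ᵐ[lam] A ⁻¹' ω := by
    intro ω
    filter_upwards [hae] with ξ hξ
    exact propext (mem_revRadialGaussImage_iff_of_eq_singleton hξ.1 ω)
  obtain ⟨C, hC, hCint⟩ := exists_signedMeasure_map_density hA hint
  refine ⟨C, fun ω hω => ⟨?_, ?_, ?_⟩, fun g hg => ?_⟩
  · exact (hA hω).nullMeasurableSet.congr (hset ω).symm
  · exact (hint.congr hDae.symm).integrableOn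
  · rw [hC ω hω, setIntegral_congr_set (hset ω)]
    exact integral_congr_ae (ae_restrict_of_ae hDae.symm)
  · have hΩ := h.isCompact.measurableSet
    obtain ⟨B, hB, hgB⟩ := exists_abs_le_of_isCompact h.isCompact hg
    have hind : Measurable (Ω.indicator g) := by
      classical
      rw [← piecewise_eq_indicator]
      exact hg.measurable_piecewise continuousOn_const hΩ
    have h1 : ∫ᵛ u in Ω, g u ∂•C = ∫ᵛ u in Ω, Ω.indicator g u ∂•C :=
      VectorMeasure.setIntegral_congr_ae
        (Eventually.of_forall fun u hu => (indicator_of_mem hu g).symm)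
    have hbdd : ∃ M, ∀ y, |Ω.indicator g y| ≤ M := by
      refine ⟨B, fun y => ?_⟩
      by_cases hy : y ∈ Ω
      · rw [indicator_of_mem hy]
        exact hgB y hy
      · simpa [indicator_of_notMem hy] using hB
    rw [h1, hCint Ω hΩ _ hind hbdd]
    have huniv : A ⁻¹' Ω =ᵐ[lam] univ := eventuallyEq_univ.2 (mem_of_superset hae fun ξ hξ => hξ.2.1)
    rw [setIntegral_congr_set huniv, setIntegral_univ]
    refine integral_congr_ae ?_
    filter_upwards [hae] with ξ hξ
    rw [indicator_of_mem hξ.2.1]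

/-! ### Variation of the gauge -/

theorem log_gauge_sub_le (h : IsWulffGenerator Ω k) {k' : Sph n → ℝ} (h' : IsWulffGenerator Ω k')
    {ξ η : Sph n} (hη : η ∈ Ω)
    (heq : inner ℝ (ξ : Rn n) (η : Rn n) / k' η = wulffGauge Ω k' ξ) :
    Real.log (wulffGauge Ω k' ξ) - Real.log (wulffGauge Ω k ξ) ≤
      Real.log (k η) - Real.log (k' η) := by
  have hp := h.pos η hη
  have hp' := h'.pos η hη
  have hN' := h'.gauge_pos ξ
  have h1 := h.inner_div_le_gauge (ξ : Rn n) hη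
  rw [div_eq_iff hp'.ne'] at heq
  rw [heq] at h1
  have h2 := Real.log_le_log (by positivity) h1
  rw [Real.log_div (by positivity) hp.ne', Real.log_mul hN'.ne' hp'.ne'] at h2
  linarith

theorem abs_log_gauge_sub_le (h : IsWulffGenerator Ω k) {k' : Sph n → ℝ}
    (h' : IsWulffGenerator Ω k') {c : ℝ}
    (hc : ∀ η ∈ Ω, |Real.log (k' η) - Real.log (k η)| ≤ c) (ξ : Sph n) :
    |Real.log (wulffGauge Ω k' ξ) - Real.log (wulffGauge Ω k ξ)| ≤ c := by
  obtain ⟨η, hη, heq⟩ := h.exists_gauge_eq (ξ : Rn n)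
  obtain ⟨η', hη', heq'⟩ := h'.exists_gauge_eq (ξ : Rn n)
  have h1 := h.log_gauge_sub_le h' hη' heq'
  have h2 := h'.log_gauge_sub_le h hη heq
  have h3 := abs_le.1 (hc η hη)
  have h4 := abs_le.1 (hc η' hη')
  exact abs_le.2 ⟨by linarith, by linarith⟩

/-- Maximizers for perturbed functions converge to the maximizer, if that is unique. -/
theorem tendsto_maximizer (h : IsWulffGenerator Ω k) {κ : ℝ → Sph n → ℝ} {δ M : ℝ} (hδ : 0 < δ)
    (hκ : ∀ ε : ℝ, |ε| < δ → IsWulffGenerator Ω (κ ε))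
    (hM : ∀ ε : ℝ, |ε| < δ → ∀ η ∈ Ω, |Real.log (κ ε η) - Real.log (k η)| ≤ M * |ε|)
    {ξ u : Sph n}
    (hu : ∀ η ∈ Ω, inner ℝ (ξ : Rn n) (η : Rn n) / k η = wulffGauge Ω k ξ → η = u)
    {η : ℝ → Sph n} (hηΩ : ∀ ε, η ε ∈ Ω)
    (hη : ∀ ε, |ε| < δ → inner ℝ (ξ : Rn n) (η ε : Rn n) / κ ε (η ε) = wulffGauge Ω (κ ε) ξ) :
    Tendsto η (𝓝 0) (𝓝 u) := by
  have hev : ∀ᶠ ε : ℝ in 𝓝 0, |ε| < δ :=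
    (isOpen_lt continuous_abs continuous_const).mem_nhds (by simpa using hδ)
  refine h.isCompact.tendsto_nhds_of_unique_mapClusterPt (Eventually.of_forall hηΩ)
    fun η' hη' hcl => hu η' hη' ?_
  refine (h.inner_div_le_gauge _ hη').antisymm (le_of_forall_lt fun c hc => ?_)
  by_contra! hle
  obtain ⟨c', hc', hlt⟩ := exists_between hc
  have hloc : ∀ᶠ y in 𝓝 η', y ∈ Ω → inner ℝ (ξ : Rn n) (y : Rn n) / k y < c' :=
    eventually_nhdsWithin_iff.1
      ((h.continuousOn_inner_div ξ η' hη').eventually_lt_const (hle.trans_lt hc'))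
  have hlim : Tendsto (fun ε : ℝ => wulffGauge Ω k ξ * Real.exp (-(2 * M * |ε|))) (𝓝 0)
      (𝓝 (wulffGauge Ω k ξ)) := by
    have : Continuous fun ε : ℝ => wulffGauge Ω k ξ * Real.exp (-(2 * M * |ε|)) := by fun_prop
    simpa using this.tendsto 0
  obtain ⟨ε, hε1, hε2, hε3⟩ :=
    ((hcl.frequently hloc).and_eventually (hev.and (hlim.eventually_const_lt hlt))).exists
  have hg := hκ ε hε2
  have hp := h.pos _ (hηΩ ε)
  have hp' := hg.pos _ (hηΩ ε)
  have hin : 0 < inner ℝ (ξ : Rn n) (η ε : Rn n) := by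
    have := hg.gauge_pos ξ
    rw [← hη ε hε2] at this
    exact (div_pos_iff_of_pos_right hp').1 this
  have h1 := (abs_le.1 (h.abs_log_gauge_sub_le hg (hM ε hε2) ξ)).1
  have h2 := (abs_le.1 (hM ε hε2 _ (hηΩ ε))).1
  rw [← hη ε hε2, Real.log_div hin.ne' hp'.ne'] at h1
  have h3 : wulffGauge Ω k ξ * Real.exp (-(2 * M * |ε|)) ≤
      inner ℝ (ξ : Rn n) (η ε : Rn n) / k (η ε) := by
    rw [← Real.log_le_log_iff (mul_pos (h.gauge_pos ξ) (Real.exp_pos _)) (div_pos hin hp),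
      Real.log_mul (h.gauge_pos ξ).ne' (Real.exp_pos _).ne', Real.log_exp,
      Real.log_div hin.ne' hp.ne']
    linarith
  exact (hε3.trans_le h3).not_gt (hε1 (hηΩ ε))

/-- Danskin's theorem for the logarithm of the gauge. -/
theorem tendsto_log_gauge (h : IsWulffGenerator Ω k) {κ : ℝ → Sph n → ℝ} {δ M : ℝ} (hδ : 0 < δ)
    (hκ : ∀ ε : ℝ, |ε| < δ → IsWulffGenerator Ω (κ ε))
    (hM : ∀ ε : ℝ, |ε| < δ → ∀ η ∈ Ω, |Real.log (κ ε η) - Real.log (k η)| ≤ M * |ε|)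
    {q : Sph n → ℝ}
    (hq : ∀ η ∈ Ω, Tendsto (fun p : ℝ × Sph n => (Real.log (κ p.1 p.2) - Real.log (k p.2)) / p.1)
      (𝓝[≠] 0 ×ˢ 𝓝[Ω] η) (𝓝 (q η)))
    {ξ u : Sph n} (huΩ : u ∈ Ω)
    (hu : ∀ η ∈ Ω, inner ℝ (ξ : Rn n) (η : Rn n) / k η = wulffGauge Ω k ξ → η = u) :
    Tendsto (fun ε => (Real.log (wulffGauge Ω (κ ε) ξ) - Real.log (wulffGauge Ω k ξ)) / ε)
      (𝓝[≠] 0) (𝓝 (-q u)) := by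
  have hueq : inner ℝ (ξ : Rn n) (u : Rn n) / k u = wulffGauge Ω k ξ := by
    obtain ⟨v, hv, hveq⟩ := h.exists_gauge_eq (ξ : Rn n)
    rwa [hu v hv hveq] at hveq
  have hex : ∀ ε : ℝ, ∃ η ∈ Ω, |ε| < δ →
      inner ℝ (ξ : Rn n) (η : Rn n) / κ ε η = wulffGauge Ω (κ ε) ξ := by
    intro ε
    by_cases hε : |ε| < δ
    · obtain ⟨η, hη, heq⟩ := (hκ ε hε).exists_gauge_eq (ξ : Rn n)
      exact ⟨η, hη, fun _ => heq⟩
    · exact ⟨u, huΩ, fun hlt => absurd hlt hε⟩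
  choose η hηΩ hη using hex
  have hηlim := (h.tendsto_maximizer hδ hκ hM hu hηΩ hη).mono_left
    (nhdsWithin_le_nhds (s := {0}ᶜ))
  have hT1 : Tendsto (fun ε => (Real.log (κ ε (η ε)) - Real.log (k (η ε))) / ε) (𝓝[≠] 0)
      (𝓝 (q u)) :=
    (hq u huΩ).comp (tendsto_id.prodMk
      (tendsto_nhdsWithin_iff.2 ⟨hηlim, Eventually.of_forall hηΩ⟩))
  have hT2 : Tendsto (fun ε => (Real.log (κ ε u) - Real.log (k u)) / ε) (𝓝[≠] 0) (𝓝 (q u)) :=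
    (hq u huΩ).comp (tendsto_id.prodMk
      (tendsto_nhdsWithin_iff.2 ⟨tendsto_const_nhds, Eventually.of_forall fun _ => huΩ⟩))
  have hev : ∀ᶠ ε : ℝ in 𝓝[≠] 0, ε ≠ 0 ∧ |ε| < δ :=
    inter_mem self_mem_nhdsWithin (mem_nhdsWithin_of_mem_nhds
      ((isOpen_lt continuous_abs continuous_const).mem_nhds (by simpa using hδ)))
  have hbd : ∀ᶠ ε : ℝ in 𝓝[≠] 0,
      (Real.log (wulffGauge Ω (κ ε) ξ) - Real.log (wulffGauge Ω k ξ)) / ε ∈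
        uIcc (-((Real.log (κ ε (η ε)) - Real.log (k (η ε))) / ε))
          (-((Real.log (κ ε u) - Real.log (k u)) / ε)) := by
    filter_upwards [hev] with ε hε
    have h1 := h.log_gauge_sub_le (hκ ε hε.2) (hηΩ ε) (hη ε hε.2)
    have h2 := (hκ ε hε.2).log_gauge_sub_le h huΩ hueq
    rw [← neg_div, ← neg_div]
    rcases lt_or_gt_of_ne hε.1 with hneg | hpos
    · refine Icc_subset_uIcc ⟨?_, ?_⟩ <;>
      · rw [div_le_div_right_of_neg hneg]
        linarith
    · refine Icc_subset_uIcc' ⟨?_, ?_⟩ <;>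
      · rw [div_le_div_iff_of_pos_right hpos]
        linarith
  refine tendsto_of_tendsto_of_tendsto_of_le_of_le' (by simpa using hT1.neg.min hT2.neg)
    (by simpa using hT1.neg.max hT2.neg) ?_ ?_ <;>
  filter_upwards [hbd] with ε hε
  exacts [hε.1, hε.2]

/-! ### Variation of the dual volume -/

theorem tendsto_dualVolume (h : IsWulffGenerator Ω k) {κ : ℝ → Sph n → ℝ} {δ M : ℝ} (hδ : 0 < δ)
    (hM0 : 0 ≤ M) (hκ : ∀ ε : ℝ, |ε| < δ → IsWulffGenerator Ω (κ ε))
    (hM : ∀ ε : ℝ, |ε| < δ → ∀ η ∈ Ω, |Real.log (κ ε η) - Real.log (k η)| ≤ M * |ε|)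
    {q : Sph n → ℝ}
    (hq : ∀ η ∈ Ω, Tendsto (fun p : ℝ × Sph n => (Real.log (κ p.1 p.2) - Real.log (k p.2)) / p.1)
      (𝓝[≠] 0 ×ˢ 𝓝[Ω] η) (𝓝 (q η)))
    {G : Sph n → ℝ → ℝ} (hG : ClassC G) {lam : Measure (Sph n)} [IsFiniteMeasure lam]
    (hlam : lam ≪ sphMeasure n) :
    Tendsto (fun ε => (dualVolume G lam (wulff Ω (κ ε)) - dualVolume G lam (wulff Ω k)) / ε)
      (𝓝[≠] 0) (𝓝 (∫ ξ, radialFn (wulff Ω k) ξ * partialT G ξ (radialFn (wulff Ω k) ξ) *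
        q (unitGradient (wulffGauge Ω k) ξ) ∂lam)) := by
  have hGcont : ∀ {k' : Sph n → ℝ}, IsWulffGenerator Ω k' →
      Continuous fun ξ : Sph n => G ξ (radialFn (wulff Ω k') ξ) := fun h' =>
    continuousOn_univ.1 (hG.comp_continuousOn continuousOn_id
      h'.continuous_radialFn_wulff.continuousOn fun ξ _ => h'.radialFn_wulff_pos ξ)
  have hGint : ∀ {k' : Sph n → ℝ}, IsWulffGenerator Ω k' →
      Integrable (fun ξ : Sph n => G ξ (radialFn (wulff Ω k') ξ)) lam := fun h' =>
    (hGcont h').integrable_of_hasCompactSupport (HasCompactSupport.of_compactSpace _)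
  have hev : ∀ᶠ ε : ℝ in 𝓝 0, |ε| < min δ 1 :=
    (isOpen_lt continuous_abs continuous_const).mem_nhds (by simpa using hδ)
  have hlog : ∀ ε : ℝ, |ε| < δ → ∀ ξ : Sph n,
      |Real.log (radialFn (wulff Ω (κ ε)) ξ) - Real.log (radialFn (wulff Ω k) ξ)| ≤ M * |ε| := by
    intro ε hε ξ
    rw [(hκ ε hε).radialFn_wulff, h.radialFn_wulff, Real.log_inv, Real.log_inv, neg_sub_neg,
      abs_sub_comm]
    exact h.abs_log_gauge_sub_le (hκ ε hε) (hM ε hε) ξ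
  have hquot : (fun ε => ∫ ξ : Sph n, (G ξ (radialFn (wulff Ω (κ ε)) ξ) -
      G ξ (radialFn (wulff Ω k) ξ)) / ε ∂lam) =ᶠ[𝓝[≠] 0]
      fun ε => (dualVolume G lam (wulff Ω (κ ε)) - dualVolume G lam (wulff Ω k)) / ε := by
    filter_upwards [mem_nhdsWithin_of_mem_nhds hev] with ε hε
    rw [integral_div, integral_sub (hGint (hκ ε (hε.trans_le (min_le_left _ _)))) (hGint h)]
    rfl
  refine Tendsto.congr' hquot ?_
  obtain ⟨r, hr, hrle⟩ := exists_pos_le_of_isCompact (isCompact_univ (X := Sph n))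
    h.continuous_radialFn_wulff.continuousOn fun ξ _ => h.radialFn_wulff_pos ξ
  obtain ⟨R, -, hRle⟩ := exists_abs_le_of_isCompact (isCompact_univ (X := Sph n))
    h.continuous_radialFn_wulff.continuousOn
  have hr' : 0 < r * Real.exp (-M) := by positivity
  obtain ⟨B, hB, hBle⟩ := exists_abs_le_of_isCompact
    (s := (univ : Set (Sph n)) ×ˢ Icc (r * Real.exp (-M)) (R * Real.exp M))
    (isCompact_univ.prod isCompact_Icc) (f := fun p => p.2 * partialT G p.1 p.2)
    (continuousOn_snd.mul (hG.continuousOn_partialT.mono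
      (prod_mono_right fun t ht => hr'.trans_le ht.1)))
  refine tendsto_integral_filter_of_dominated_convergence (fun _ => M * B) ?_ ?_
    (integrable_const _) ?_
  · filter_upwards [mem_nhdsWithin_of_mem_nhds hev] with ε hε
    exact (((hGcont (hκ ε (hε.trans_le (min_le_left _ _)))).sub
      (hGcont h)).div_const ε).aestronglyMeasurable
  · filter_upwards [mem_nhdsWithin_of_mem_nhds hev, self_mem_nhdsWithin] with ε hε hε0
    refine Eventually.of_forall fun ξ => ?_
    have hεδ := hε.trans_le (min_le_left _ _)
    have hε1 := hε.trans_le (min_le_right _ _)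
    have hρ := h.radialFn_wulff_pos ξ
    have hρε := (hκ ε hεδ).radialFn_wulff_pos ξ
    have hrρ : r ≤ radialFn (wulff Ω k) ξ := hrle ξ (mem_univ _)
    have hRρ : radialFn (wulff Ω k) ξ ≤ R := (le_abs_self _).trans (hRle ξ (mem_univ _))
    have hl := hlog ε hεδ ξ
    have hlM := abs_le.1 (hl.trans (mul_le_of_le_one_right hM0 hε1.le))
    obtain ⟨s, hs, hseq⟩ := exists_log_sub_log_mul_eq (hG.differentiableAt ξ) hρ hρε
    have hmem : ∀ t : ℝ, 0 < t →
        -M ≤ Real.log t - Real.log (radialFn (wulff Ω k) ξ) ∧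
          Real.log t - Real.log (radialFn (wulff Ω k) ξ) ≤ M →
        t ∈ Icc (r * Real.exp (-M)) (R * Real.exp M) := by
      intro t ht htM
      have hR0 : 0 < R := hρ.trans_le hRρ
      have h3 := Real.log_le_log hr hrρ
      have h4 := Real.log_le_log hρ hRρ
      constructor
      · rw [← Real.log_le_log_iff (by positivity) ht, Real.log_mul hr.ne' (Real.exp_pos _).ne',
          Real.log_exp]
        linarith
      · rw [← Real.log_le_log_iff ht (by positivity), Real.log_mul hR0.ne' (Real.exp_pos _).ne',
          Real.log_exp]
        linarith
    have hsmem := (uIcc_subset_Icc (hmem _ hρ (by simpa using hM0)) (hmem _ hρε hlM)) hs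
    have hBs : |s * partialT G ξ s| ≤ B := hBle (ξ, s) ⟨mem_univ _, hsmem⟩
    rw [Real.norm_eq_abs, abs_div, div_le_iff₀ (abs_pos.2 hε0), ← hseq, abs_mul]
    calc _ ≤ M * |ε| * B := mul_le_mul hl hBs (abs_nonneg _) (by positivity)
      _ = M * B * |ε| := by ring
  · filter_upwards [hlam.ae_le h.ae_radialGaussImage_eq] with ξ hξ
    set u := unitGradient (wulffGauge Ω k) ξ
    have h00 : |(0 : ℝ)| < δ := by simpa using hδ
    have hl0 : Real.log (radialFn (wulff Ω (κ 0)) ξ) = Real.log (radialFn (wulff Ω k) ξ) := by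
      have := hlog 0 h00 ξ
      rw [abs_zero, mul_zero] at this
      exact sub_eq_zero.1 (abs_nonpos_iff.1 this)
    have hexp0 : Real.exp (Real.log (radialFn (wulff Ω k) ξ)) = radialFn (wulff Ω k) ξ :=
      Real.exp_log (h.radialFn_wulff_pos ξ)
    have hL : HasDerivAt (fun ε => Real.log (radialFn (wulff Ω (κ ε)) ξ)) (q u) 0 := by
      rw [hasDerivAt_iff_tendsto_slope]
      have h1 := (h.tendsto_log_gauge hδ hκ hM hq hξ.2.1 hξ.2.2.2).neg
      rw [neg_neg] at h1
      refine h1.congr' ?_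
      filter_upwards [mem_nhdsWithin_of_mem_nhds hev] with ε hε
      rw [slope_def_field, hl0, (hκ ε (hε.trans_le (min_le_left _ _))).radialFn_wulff,
        h.radialFn_wulff, Real.log_inv, Real.log_inv, sub_zero]
      ring
    have hE := hL.exp
    rw [hl0, hexp0] at hE
    have hGd : HasDerivAt (G ξ) (partialT G ξ (radialFn (wulff Ω k) ξ))
        (Real.exp (Real.log (radialFn (wulff Ω (κ 0)) ξ))) := by
      rw [hl0, hexp0]
      exact (hG.differentiableAt ξ _ (h.radialFn_wulff_pos ξ)).hasDerivAt
    have hcomp := hasDerivAt_iff_tendsto_slope.1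
      (HasDerivAt.comp (h₂ := G ξ) (0 : ℝ) hGd hE)
    have hval : partialT G ξ (radialFn (wulff Ω k) ξ) * (radialFn (wulff Ω k) ξ * q u) =
        radialFn (wulff Ω k) ξ * partialT G ξ (radialFn (wulff Ω k) ξ) * q u := by ring
    rw [hval] at hcomp
    refine hcomp.congr' ?_
    filter_upwards [mem_nhdsWithin_of_mem_nhds hev] with ε hε
    rw [slope_def_field, Function.comp_apply, Function.comp_apply, hl0, hexp0,
      Real.exp_log ((hκ ε (hε.trans_le (min_le_left _ _))).radialFn_wulff_pos ξ), sub_zero]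

end IsWulffGenerator

/-! ### The variational formula -/

/-- Outside the null set where it fails, `h_K(α_K(ξ)) = k(α_K(ξ))`, which turns the density of the
Gauss image measure into that of the variational formula. -/
theorem integral_density_eq {n : ℕ} {Ω : Set (Sph n)} {k : Sph n → ℝ}
    (h : IsWulffGenerator Ω k) {lam : Measure (Sph n)} (hlam : lam ≪ sphMeasure n)
    {J w g q : Sph n → ℝ}
    (hwq : ∀ u ∈ Ω, supportFn (wulff Ω k) u = k u → w u * g u = q u) :
    ∫ ξ, J ξ * w (unitGradient (wulffGauge Ω k) ξ) * g (unitGradient (wulffGauge Ω k) ξ) ∂lam =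
      ∫ ξ, J ξ * q (unitGradient (wulffGauge Ω k) ξ) ∂lam := by
  refine integral_congr_ae ?_
  filter_upwards [hlam.ae_le h.ae_radialGaussImage_eq] with ξ hξ
  rw [mul_assoc, hwq _ hξ.2.1 hξ.2.2.1]

theorem IsWulffGenerator.continuous_radialFn_mul_partialT {n : ℕ} {Ω : Set (Sph n)}
    {k : Sph n → ℝ} (h : IsWulffGenerator Ω k) {G : Sph n → ℝ → ℝ} (hG : ClassC G) :
    Continuous fun ξ : Sph n =>
      radialFn (wulff Ω k) ξ * partialT G ξ (radialFn (wulff Ω k) ξ) :=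
  h.continuous_radialFn_wulff.mul (continuousOn_univ.1 (hG.partialT_comp_continuousOn
    continuousOn_id h.continuous_radialFn_wulff.continuousOn fun ξ _ => h.radialFn_wulff_pos ξ))

theorem continuous_inv_mul_partialT {n : ℕ} {Ψ : Sph n → ℝ → ℝ} (hΨ : ClassCI Ψ ∨ ClassCd Ψ)
    {r : Sph n → ℝ} (hr : Continuous r) (hpos : ∀ u, 0 < r u) :
    Continuous fun u : Sph n => (r u * partialT Ψ u (r u))⁻¹ :=
  (hr.mul (continuousOn_univ.1 ((classC_of_CI_or_Cd hΨ).partialT_comp_continuousOn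
    continuousOn_id hr.continuousOn fun u _ => hpos u))).inv₀
    fun u => mul_ne_zero (hpos u).ne' (partialT_ne_zero hΨ u (hpos u))

/-- The variational formula for Wulff shapes along a family of generating functions. -/
theorem IsWulffGenerator.wulff_variation {n : ℕ} {Ω : Set (Sph n)} {k : Sph n → ℝ}
    (h : IsWulffGenerator Ω k) {κ : ℝ → Sph n → ℝ} {δ M : ℝ} (hδ : 0 < δ)
    (hM0 : 0 ≤ M) (hκ : ∀ ε : ℝ, |ε| < δ → IsWulffGenerator Ω (κ ε))
    (hM : ∀ ε : ℝ, |ε| < δ → ∀ η ∈ Ω, |Real.log (κ ε η) - Real.log (k η)| ≤ M * |ε|)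
    {q : Sph n → ℝ}
    (hq : ∀ η ∈ Ω, Tendsto (fun p : ℝ × Sph n => (Real.log (κ p.1 p.2) - Real.log (k p.2)) / p.1)
      (𝓝[≠] 0 ×ˢ 𝓝[Ω] η) (𝓝 (q η)))
    {G : Sph n → ℝ → ℝ} (hG : ClassC G) {lam : Measure (Sph n)} [IsFiniteMeasure lam]
    (hlam : lam ≪ sphMeasure n) {D w g : Sph n → ℝ} (hw : Continuous w) (hg : ContinuousOn g Ω)
    (hD : ∀ ξ, D ξ = radialFn (wulff Ω k) ξ * partialT G ξ (radialFn (wulff Ω k) ξ) *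
      w (radialGaussMap (wulff Ω k) ξ))
    (hwq : ∀ u ∈ Ω, supportFn (wulff Ω k) u = k u → w u * g u = q u) :
    ∃ C : SignedMeasure (Sph n),
      (∀ ω : Set (Sph n), MeasurableSet ω →
        NullMeasurableSet (revRadialGaussImage (wulff Ω k) ω) lam ∧
        IntegrableOn D (revRadialGaussImage (wulff Ω k) ω) lam ∧
        C ω = ∫ ξ in revRadialGaussImage (wulff Ω k) ω, D ξ ∂lam) ∧
      Tendsto (fun ε => (dualVolume G lam (wulff Ω (κ ε)) - dualVolume G lam (wulff Ω k)) / ε)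
        (𝓝[≠] 0) (𝓝 (∫ᵛ u in Ω, g u ∂•C)) := by
  obtain ⟨C, hC, hCg⟩ := h.exists_gaussImageMeasure hlam
    (h.continuous_radialFn_mul_partialT hG) hw hD
  refine ⟨C, hC, ?_⟩
  rw [hCg g hg, integral_density_eq h hlam hwq]
  exact h.tendsto_dualVolume hδ hM0 hκ hM hq hG hlam

end MusielakOrlicz

end

open MusielakOrlicz in
theorem mainTheorem2 (n : ℕ) (hn : 2 ≤ n)
    (Ω : Set (Sph n)) (hΩ : IsClosed Ω) (hΩh : ¬ InClosedHemisphere Ω)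
    (G Ψ : Sph n → ℝ → ℝ) (hG : ClassC G) (hΨ : ClassCI Ψ ∨ ClassCd Ψ)
    (lam : Measure (Sph n)) (hlam : ClassM lam)
    (f g : Sph n → ℝ) (hf : ContinuousOn f Ω) (hfpos : ∀ ξ ∈ Ω, 0 < f ξ)
    (hg : ContinuousOn g Ω) :
    -- the perturbation is well defined, positive and continuous on `Ω` for small `ε`
    (∃ δ : ℝ, 0 < δ ∧ ∀ ε : ℝ, |ε| < δ →
      ContinuousOn (moAdd Ψ f g ε) Ω ∧
      ∀ ξ ∈ Ω, 0 < moAdd Ψ f g ε ξ ∧ Ψ ξ (moAdd Ψ f g ε ξ) = Ψ ξ (f ξ) + ε * g ξ) ∧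
    -- variational formula for the polar of the convex hull
    (∃ C : SignedMeasure (Sph n),
      IsPolarMOGaussImageMeasure G Ψ lam (polarBody (hull Ω f)) C ∧
      Tendsto (fun ε : ℝ =>
          (dualVolume G lam (polarBody (hull Ω (moAdd Ψ f g ε))) -
            dualVolume G lam (polarBody (hull Ω f))) / ε)
        (𝓝[≠] 0) (𝓝 (-∫ᵛ u in Ω, g u ∂•C))) ∧
    -- variational formula for the Wulff shape
    (∃ C : SignedMeasure (Sph n),
      IsMOGaussImageMeasure G Ψ lam (wulff Ω f) C ∧
      Tendsto (fun ε : ℝ =>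
          (dualVolume G lam (wulff Ω (moAdd Ψ f g ε)) - dualVolume G lam (wulff Ω f)) / ε)
        (𝓝[≠] 0) (𝓝 (∫ᵛ u in Ω, g u ∂•C))) := by
  have := hlam.finite
  have hac := hlam.absolutelyContinuous
  have hΩc : IsCompact Ω := hΩ.isCompact
  have hne : Ω.Nonempty := by
    rw [nonempty_iff_ne_empty]
    rintro rfl
    have : Nontrivial (Rn n) :=
      Module.nontrivial_of_finrank_pos (R := ℝ) (by rw [finrank_euclideanSpace_fin]; omega)
    obtain ⟨u, hu⟩ := NormedSpace.sphere_nonempty (x := (0 : Rn n)) (r := 1).2 zero_le_one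
    exact hΩh ⟨⟨u, hu⟩, by simp⟩
  obtain ⟨a, b, δ, ha, hδ, hF⟩ := exists_moAdd_bounds hΨ hΩc hf hfpos hg
  have hpos : ∀ ε : ℝ, |ε| < δ → ∀ ξ ∈ Ω, 0 < moAdd Ψ f g ε ξ := fun ε hε ξ hξ =>
    ha.trans (hF ε hε ξ hξ).1.1
  have hfab : ∀ ξ ∈ Ω, f ξ ∈ Ioo a b := fun ξ hξ => by
    rw [← moAdd_zero hΨ f g (hfpos ξ hξ)]
    exact (hF 0 (by simpa using hδ) ξ hξ).1
  have hjoint := continuousOn_perturbation hΨ hf hfpos hg fun ε hε ξ hξ =>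
    ⟨hpos ε hε ξ hξ, (hF ε hε ξ hξ).2⟩
  have hcont : ∀ ε : ℝ, |ε| < δ → ContinuousOn (moAdd Ψ f g ε) Ω := fun ε hε =>
    hjoint.comp (f := fun ξ => (ε, ξ)) (by fun_prop) fun ξ hξ => ⟨hε, hξ⟩
  obtain ⟨⟨M, hM0, hM⟩, hq⟩ := log_perturbation hΨ hΩc hf hfpos hg ha hδ hfab hF
  have hgen : ∀ {k : Sph n → ℝ}, ContinuousOn k Ω → (∀ ξ ∈ Ω, 0 < k ξ) → IsWulffGenerator Ω k :=
    fun hk hkpos => ⟨hΩc, hne, hΩh, hk, hkpos⟩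
  have hgen_inv : ∀ {k : Sph n → ℝ}, ContinuousOn k Ω → (∀ ξ ∈ Ω, 0 < k ξ) →
      IsWulffGenerator Ω fun ξ => (k ξ)⁻¹ := fun hk hkpos =>
    hgen (hk.inv₀ fun ξ hξ => (hkpos ξ hξ).ne') fun ξ hξ => inv_pos.2 (hkpos ξ hξ)
  refine ⟨⟨δ, hδ, fun ε hε => ⟨hcont ε hε, fun ξ hξ => ⟨hpos ε hε ξ hξ, (hF ε hε ξ hξ).2⟩⟩⟩,
    ?_, ?_⟩
  · have h := hgen_inv hf hfpos
    have hneg : ∀ x y : ℝ, Real.log x⁻¹ - Real.log y⁻¹ = -(Real.log x - Real.log y) := fun x y => by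
      rw [Real.log_inv, Real.log_inv]
      ring
    have hρ : ∀ u : Sph n, 0 < radialFn (polarBody (wulff Ω fun ξ => (f ξ)⁻¹)) u := fun u => by
      rw [h.radialFn_polarBody_wulff]
      exact inv_pos.2 (h.supportFn_pos u)
    have hρc : Continuous fun u : Sph n => radialFn (polarBody (wulff Ω fun ξ => (f ξ)⁻¹)) u := by
      simp only [h.radialFn_polarBody_wulff]
      exact (h.continuous_supportFn.comp continuous_subtype_val).inv₀ fun u =>
        (h.supportFn_pos u).ne'
    obtain ⟨C, hC, hlim⟩ := h.wulff_variation (κ := fun ε ξ => (moAdd Ψ f g ε ξ)⁻¹)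
      (q := fun η => -(g η / (f η * partialT Ψ η (f η)))) (g := fun u => -g u)
      (D := polarMODensity G Ψ (wulff Ω fun ξ => (f ξ)⁻¹)) hδ hM0
      (fun ε hε => hgen_inv (hcont ε hε) (hpos ε hε))
      (fun ε hε η hη => by rw [hneg, abs_neg]; exact hM ε hε η hη)
      (fun η hη => by simpa only [hneg, neg_div] using (hq η hη).neg) hG hac
      (continuous_inv_mul_partialT hΨ hρc hρ) hg.neg
      (fun ξ => div_eq_mul_inv _ _)
      (fun u _ hu => by
        simp only [h.radialFn_polarBody_wulff, hu, inv_inv]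
        ring)
    rw [polarBody_hull hfpos]
    refine ⟨C, hC, ?_⟩
    rw [← VectorMeasure.integral_fun_neg]
    refine hlim.congr' ?_
    have hev : ∀ᶠ ε : ℝ in 𝓝[≠] 0, |ε| < δ := mem_nhdsWithin_of_mem_nhds
      ((isOpen_lt continuous_abs continuous_const).mem_nhds (by simpa using hδ))
    filter_upwards [hev] with ε hε
    rw [polarBody_hull (hpos ε hε)]
  · have h := hgen hf hfpos
    obtain ⟨C, hC, hlim⟩ := h.wulff_variation (κ := moAdd Ψ f g)
      (D := moDensity G Ψ (wulff Ω f)) hδ hM0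
      (fun ε hε => hgen (hcont ε hε) (hpos ε hε)) hM hq hG hac
      (continuous_inv_mul_partialT hΨ
        (h.continuous_supportFn.comp continuous_subtype_val) h.supportFn_pos) hg
      (fun ξ => div_eq_mul_inv _ _)
      (fun u _ hu => by
        simp only [Function.comp_apply, hu]
        ring)
    exact ⟨C, hC, hlim⟩
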